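/- Let $K$ be a field of characteristic $0$, let $d\ge 1$, let $F_d=L_d/L_d''$ be the free metabelian Lie algebra over $K$ freely generated by $x_1,\dots,x_d$ ($L_d$ being the free Lie algebra), and let $F_d'=[F_d,F_d]$. Write $u\,\mathrm{ad}\,z=[u,z]$. For $w\in F_d'$ and $f\in K[X_d]=K[x_1,\dots,x_d]$ put $w\,f(\mathrm{ad}X_d)=w\,f(\mathrm{ad}\,x_1,\dots,\mathrm{ad}\,x_d)$; this is well defined because the operators $\mathrm{ad}\,x_i$ commute on $F_d'$. Let $$R_d=P(A_d,Y_d)/(a_ia_j,\ [a_i,a_j],\ [y_i,y_j],\ [a_i,y_j]-a_iy_j\mid i,j=1,\dots,d),$$ where $P(A_d,Y_d)$ is the free commutative unital Poisson algebra on $a_1,\dots,a_d,y_1,\dots,y_d$ and the ideal is the Poisson ideal generated by the listed elements. The homomorphism of Lie algebras $F_d\to R_d$ with $x_j\mapsto a_j+y_j$ is injective, and $F_d$ is regarded as a Lie subalgebra of $R_d$. For $f_1,f_2\in K[X_d]$ put $$\pi(f_1,f_2)=[f_1(a_1+y_1,\dots,a_d+y_d),\,f_2(a_1+y_1,\dots,a_d+y_d)]\in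 R_d.$$ Let $SL_2(K)$ act rationally on the vector space $KX_d$ with basis $x_1,\dots,x_d$, and extend the action to $F_d$ and to $K[X_d]$ by $g(f(x_1,\dots,x_d))=f(gx_1,\dots,gx_d)$. Assume that $x_d$ is $SL_2(K)$-invariant and that $KX_d=KX_{d-1}\oplus Kx_d$ as $SL_2(K)$-modules, where $KX_{d-1}$ is spanned by $x_1,\dots,x_{d-1}$. Let $\{v_i\mid i\in I\}$ and $\{u_j\mid j\in J\}$ be bases, consisting of elements homogeneous with respect to the usual $\mathbb Z$-grading, of $(F_{d-1}')^{SL_2(K)}$ and of $\omega(K[X_{d-1}])^{SL_2(K)}$ respectively, where $\omega(K[X_{d-1}])$ is the augmentation ideal of $K[X_{d-1}]$ (the polynomials without constant term). Then $(F_d')^{SL_2(K)}\subset R_d$ has a basis consisting of the elements $$v_iy_d^n=v_i\,\mathrm{ad}^nx_d,\qquad i\in I,\ n\ge 0,$$ $$\pi(x_d,u_j)\,y_d^n=\sum_{k=1}^{d-1}[x_d,x_k]\,\frac{\partial u_j}{\partial x_k}(\mathrm{ad}X_{d-1})\,\mathrm{ad}^nx_d,\qquad j\in J,\ n\ge 0.$$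 -/

import Mathlib

/-! # Free metabelian Lie algebras inside a Poisson algebra, and invariants of linear groups -/

namespace MetabelianInvariants

/-! ## Commutative Poisson algebras presented by generators and relations -/

section Presented

/-- Formal unital Poisson polynomials over `K` in the generators `X`. -/
inductive PoissonTerm (K X : Type*) where
  | gen : X → PoissonTerm K X
  | scalar : K → PoissonTerm K X
  | add : PoissonTerm K X → PoissonTerm K X → PoissonTerm K X
  | mul : PoissonTerm K X → PoissonTerm K X → PoissonTerm K X
  | brk : PoissonTerm K X → PoissonTerm K X → PoissonTerm K X

open PoissonTerm in
/-- The laws of commutative unital Poisson `K`-algebras (a commutative associative algebra that is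
a Lie algebra, with the Leibniz rule), together with the extra relations `r`. -/
inductive PoissonRel {K X : Type*} [CommRing K]
    (r : PoissonTerm K X → PoissonTerm K X → Prop) :
    PoissonTerm K X → PoissonTerm K X → Prop
  | of_rel {f g} : r f g → PoissonRel r f g
  | add_scalar {c d : K} : PoissonRel r (scalar (c + d)) (add (scalar c) (scalar d))
  | mul_scalar {c d : K} : PoissonRel r (scalar (c * d)) (mul (scalar c) (scalar d))
  | add_assoc {f g h} : PoissonRel r (add (add f g) h) (add f (add g h))
  | add_comm {f g} : PoissonRel r (add f g) (add g f)
  | zero_add {f} : PoissonRel r (add (scalar 0) f) f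
  | mul_assoc {f g h} : PoissonRel r (mul (mul f g) h) (mul f (mul g h))
  | mul_comm {f g} : PoissonRel r (mul f g) (mul g f)
  | one_mul {f} : PoissonRel r (mul (scalar 1) f) f
  | zero_mul {f} : PoissonRel r (mul (scalar 0) f) (scalar 0)
  | mul_add {f g h} : PoissonRel r (mul f (add g h)) (add (mul f g) (mul f h))
  | add_brk {f g h} : PoissonRel r (brk (add f g) h) (add (brk f h) (brk g h))
  | brk_add {f g h} : PoissonRel r (brk f (add g h)) (add (brk f g) (brk f h))
  | brk_smul {c f g} : PoissonRel r (brk f (mul (scalar c) g)) (mul (scalar c) (brk f g))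
  | brk_self {f} : PoissonRel r (brk f f) (scalar 0)
  | jacobi {f g h} :
      PoissonRel r (brk f (brk g h)) (add (brk (brk f g) h) (brk g (brk f h)))
  | leibniz {f g h} :
      PoissonRel r (brk (mul f g) h) (add (mul (brk f h) g) (mul f (brk g h)))
  | add_left {f g h} : PoissonRel r f g → PoissonRel r (add f h) (add g h)
  | add_right {f g h} : PoissonRel r f g → PoissonRel r (add h f) (add h g)
  | mul_left {f g h} : PoissonRel r f g → PoissonRel r (mul f h) (mul g h)
  | mul_right {f g h} : PoissonRel r f g → PoissonRel r (mul h f) (mul h g)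
  | brk_left {f g h} : PoissonRel r f g → PoissonRel r (brk f h) (brk g h)
  | brk_right {f g h} : PoissonRel r f g → PoissonRel r (brk h f) (brk h g)

/-- The commutative Poisson `K`-algebra with generators `X` and defining relations `r`, i.e. the
free Poisson algebra on `X` modulo the Poisson ideal generated by all `f - g` with `r f g`. -/
def PresentedPoisson {K X : Type*} [CommRing K]
    (r : PoissonTerm K X → PoissonTerm K X → Prop) : Type _ :=
  Quot (PoissonRel r)

namespace PresentedPoisson

variable {K X : Type*} [CommRing K] {r : PoissonTerm K X → PoissonTerm K X → Prop}

/-- The element represented by a term. -/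
def mk (r : PoissonTerm K X → PoissonTerm K X → Prop) (f : PoissonTerm K X) :
    PresentedPoisson r :=
  Quot.mk _ f

instance : Zero (PresentedPoisson r) := ⟨mk r (.scalar 0)⟩

instance : One (PresentedPoisson r) := ⟨mk r (.scalar 1)⟩

instance : Add (PresentedPoisson r) :=
  ⟨Quot.map₂ .add (fun _ _ _ => .add_right) (fun _ _ _ => .add_left)⟩

instance : Mul (PresentedPoisson r) :=
  ⟨Quot.map₂ .mul (fun _ _ _ => .mul_right) (fun _ _ _ => .mul_left)⟩

instance : Neg (PresentedPoisson r) := ⟨fun f => mk r (.scalar (-1)) * f⟩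

instance : CommRing (PresentedPoisson r) where
  add_assoc := by rintro ⟨f⟩ ⟨g⟩ ⟨h⟩; exact Quot.sound .add_assoc
  zero_add := by rintro ⟨f⟩; exact Quot.sound .zero_add
  add_zero := by
    rintro ⟨f⟩
    exact (Quot.sound PoissonRel.add_comm).trans (Quot.sound .zero_add)
  add_comm := by rintro ⟨f⟩ ⟨g⟩; exact Quot.sound .add_comm
  mul_assoc := by rintro ⟨f⟩ ⟨g⟩ ⟨h⟩; exact Quot.sound .mul_assoc
  mul_comm := by rintro ⟨f⟩ ⟨g⟩; exact Quot.sound .mul_comm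
  one_mul := by rintro ⟨f⟩; exact Quot.sound .one_mul
  mul_one := by
    rintro ⟨f⟩
    exact (Quot.sound PoissonRel.mul_comm).trans (Quot.sound .one_mul)
  zero_mul := by rintro ⟨f⟩; exact Quot.sound .zero_mul
  mul_zero := by
    rintro ⟨f⟩
    exact (Quot.sound PoissonRel.mul_comm).trans (Quot.sound .zero_mul)
  left_distrib := by rintro ⟨f⟩ ⟨g⟩ ⟨h⟩; exact Quot.sound .mul_add
  right_distrib := by
    rintro ⟨f⟩ ⟨g⟩ ⟨h⟩
    refine (Quot.sound PoissonRel.mul_comm).trans ((Quot.sound PoissonRel.mul_add).trans ?_)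
    exact (Quot.sound (PoissonRel.add_left PoissonRel.mul_comm)).trans
      (Quot.sound (PoissonRel.add_right PoissonRel.mul_comm))
  neg_add_cancel := by
    rintro ⟨f⟩
    refine (Quot.sound (PoissonRel.add_right (PoissonRel.one_mul (f := f)))).symm.trans ?_
    refine (Quot.sound (PoissonRel.add_left PoissonRel.mul_comm)).trans ?_
    refine (Quot.sound (PoissonRel.add_right PoissonRel.mul_comm)).trans ?_
    refine (Quot.sound (PoissonRel.mul_add (f := f) (g := .scalar (-1)) (h := .scalar 1))).symm.trans
      ?_
    refine (Quot.sound (PoissonRel.mul_right PoissonRel.add_scalar)).symm.trans ?_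
    rw [neg_add_cancel]
    exact (Quot.sound PoissonRel.mul_comm).trans (Quot.sound .zero_mul)
  nsmul := nsmulRec
  zsmul := zsmulRec

instance : Algebra K (PresentedPoisson r) where
  smul c f := mk r (.scalar c) * f
  algebraMap :=
    { toFun := fun c => mk r (.scalar c)
      map_one' := rfl
      map_zero' := rfl
      map_mul' := fun _ _ => Quot.sound .mul_scalar
      map_add' := fun _ _ => Quot.sound .add_scalar }
  commutes' _ _ := mul_comm _ _
  smul_def' _ _ := rfl

/-- The Poisson bracket. -/
instance : Bracket (PresentedPoisson r) (PresentedPoisson r) :=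
  ⟨Quot.map₂ .brk (fun _ _ _ => .brk_right) (fun _ _ _ => .brk_left)⟩

instance : LieRing (PresentedPoisson r) where
  add_lie := by rintro ⟨f⟩ ⟨g⟩ ⟨h⟩; exact Quot.sound .add_brk
  lie_add := by rintro ⟨f⟩ ⟨g⟩ ⟨h⟩; exact Quot.sound .brk_add
  lie_self := by rintro ⟨f⟩; exact Quot.sound .brk_self
  leibniz_lie := by rintro ⟨f⟩ ⟨g⟩ ⟨h⟩; exact Quot.sound .jacobi

instance : LieAlgebra K (PresentedPoisson r) where
  lie_smul := by rintro c ⟨f⟩ ⟨g⟩; exact Quot.sound .brk_smul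

theorem mul_lie (f g h : PresentedPoisson r) : ⁅f * g, h⁆ = ⁅f, h⁆ * g + f * ⁅g, h⁆ := by
  rcases f with ⟨f⟩; rcases g with ⟨g⟩; rcases h with ⟨h⟩
  exact Quot.sound .leibniz

theorem lie_mul (f g h : PresentedPoisson r) : ⁅h, f * g⁆ = ⁅h, f⁆ * g + f * ⁅h, g⁆ := by
  rw [← lie_skew, mul_lie, ← lie_skew h f, ← lie_skew h g]
  ring

theorem lie_algebraMap (c : K) (f : PresentedPoisson r) :
    ⁅f, algebraMap K (PresentedPoisson r) c⁆ = 0 := by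
  have h1 : ⁅f, (1 : PresentedPoisson r)⁆ = 0 := by
    have h := lie_mul (1 : PresentedPoisson r) 1 f
    simpa using h
  rw [Algebra.algebraMap_eq_smul_one]
  have := LieAlgebra.lie_smul c f (1:PresentedPoisson r)
  exact this.trans (by rw [h1, smul_zero])

/-- Elements of a presented Poisson algebra are built from the generators and the scalars. -/
theorem induction {p : PresentedPoisson r → Prop}
    (gen : ∀ x, p (mk r (.gen x))) (scalar : ∀ c, p (algebraMap K _ c))
    (add : ∀ f g, p f → p g → p (f + g)) (mul : ∀ f g, p f → p g → p (f * g))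
    (lie : ∀ f g, p f → p g → p ⁅f, g⁆) (f : PresentedPoisson r) : p f := by
  rcases f with ⟨f⟩
  induction f with
  | gen x => exact gen x
  | scalar c => exact scalar c
  | add f g hf hg => exact add _ _ hf hg
  | mul f g hf hg => exact mul _ _ hf hg
  | brk f g hf hg => exact lie _ _ hf hg

end PresentedPoisson

end Presented

/-! ## The Poisson algebra `R_d` -/

section PoissonR

open PoissonTerm in
/-- The relations `a_i a_j = 0`, `[a_i, a_j] = 0`, `[y_i, y_j] = 0`, `[a_i, y_j] = a_i y_j`; the
generator `a_i` is `Sum.inl i` and `y_i` is `Sum.inr i`. -/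
inductive WreathRel (K : Type*) [CommRing K] (d : ℕ) :
    PoissonTerm K (Fin d ⊕ Fin d) → PoissonTerm K (Fin d ⊕ Fin d) → Prop
  | mul_a (i j) : WreathRel K d (mul (gen (.inl i)) (gen (.inl j))) (scalar 0)
  | brk_a (i j) : WreathRel K d (brk (gen (.inl i)) (gen (.inl j))) (scalar 0)
  | brk_y (i j) : WreathRel K d (brk (gen (.inr i)) (gen (.inr j))) (scalar 0)
  | brk_ay (i j) :
      WreathRel K d (brk (gen (.inl i)) (gen (.inr j))) (mul (gen (.inl i)) (gen (.inr j)))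

/-- The Poisson algebra `R_d = P(A_d, Y_d) / (a_i a_j, [a_i, a_j], [y_i, y_j], [a_i, y_j] - a_i y_j)`,
where `P(A_d, Y_d)` is the free Poisson algebra on `a_1, …, a_d, y_1, …, y_d`. -/
abbrev PoissonR (K : Type*) [CommRing K] (d : ℕ) : Type _ := PresentedPoisson (WreathRel K d)

variable (K : Type*) [CommRing K] {d : ℕ}

/-- The generator `a_i` of `R_d`. -/
def aGen (i : Fin d) : PoissonR K d := .mk _ (.gen (.inl i))

/-- The generator `y_i` of `R_d`. -/
def yGen (i : Fin d) : PoissonR K d := .mk _ (.gen (.inr i))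

/-- `π(f₁, f₂) = [f₁(A_d + Y_d), f₂(A_d + Y_d)] ∈ R_d` (Poisson bracket). -/
noncomputable def poissonPi (f₁ f₂ : MvPolynomial (Fin d) K) : PoissonR K d :=
  ⁅MvPolynomial.aeval (fun i => aGen K i + yGen K i) f₁,
    MvPolynomial.aeval (fun i => aGen K i + yGen K i) f₂⁆

theorem aGen_mul_aGen (i j : Fin d) : aGen K i * aGen K j = 0 :=
  Quot.sound (.of_rel (.mul_a i j))

theorem aGen_lie_aGen (i j : Fin d) : ⁅aGen K i, aGen K j⁆ = 0 :=
  Quot.sound (.of_rel (.brk_a i j))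

theorem yGen_lie_yGen (i j : Fin d) : ⁅yGen K i, yGen K j⁆ = 0 :=
  Quot.sound (.of_rel (.brk_y i j))

theorem aGen_lie_yGen (i j : Fin d) : ⁅aGen K i, yGen K j⁆ = aGen K i * yGen K j :=
  Quot.sound (.of_rel (.brk_ay i j))

/-- The (associative) ideal of `R_d` generated by `a_1, …, a_d`. -/
def aIdeal (d : ℕ) : Ideal (PoissonR K d) := Ideal.span (Set.range (aGen K))

variable {K}

theorem lie_mem_of_forall_aGen {g : PoissonR K d} (hg : ∀ i : Fin d, ⁅aGen K i, g⁆ ∈ aIdeal K d)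
    {x : PoissonR K d} (hx : x ∈ aIdeal K d) : ⁅x, g⁆ ∈ aIdeal K d := by
  refine Submodule.span_induction ?_ ?_ ?_ ?_ hx
  · rintro _ ⟨i, rfl⟩
    exact hg i
  · rw [zero_lie]; exact zero_mem _
  · intro x y _ _ hx hy
    rw [add_lie]; exact add_mem hx hy
  · intro c x hx' hx
    rw [smul_eq_mul, PresentedPoisson.mul_lie]
    exact add_mem (Ideal.mul_mem_left _ _ hx') (Ideal.mul_mem_left _ _ hx)

theorem aGen_mem (i : Fin d) : aGen K i ∈ aIdeal K d := Ideal.subset_span ⟨i, rfl⟩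

theorem aIdeal_lie_mem {x : PoissonR K d} (hx : x ∈ aIdeal K d) (g : PoissonR K d) :
    ⁅x, g⁆ ∈ aIdeal K d := by
  revert x
  refine PresentedPoisson.induction
    (p := fun g => ∀ {x}, x ∈ aIdeal K d → ⁅x, g⁆ ∈ aIdeal K d) ?_ ?_ ?_ ?_ ?_ g
  · rintro (j | j) x hx
    · refine lie_mem_of_forall_aGen (fun i => ?_) hx
      change ⁅aGen K i, aGen K j⁆ ∈ _
      rw [aGen_lie_aGen]; exact zero_mem _
    · refine lie_mem_of_forall_aGen (fun i => ?_) hx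
      change ⁅aGen K i, yGen K j⁆ ∈ _
      rw [aGen_lie_yGen]; exact Ideal.mul_mem_right _ _ (aGen_mem i)
  · intro c x _
    rw [PresentedPoisson.lie_algebraMap]; exact zero_mem _
  · intro f g hf hg x hx
    rw [lie_add]; exact add_mem (hf hx) (hg hx)
  · intro f g hf hg x hx
    rw [PresentedPoisson.lie_mul]
    exact add_mem (Ideal.mul_mem_right _ _ (hf hx)) (Ideal.mul_mem_left _ _ (hg hx))
  · intro f g hf hg x hx
    rw [leibniz_lie, ← lie_skew f ⁅x, g⁆]
    exact add_mem (hg (hf hx)) (neg_mem (hf (hg hx)))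

theorem lie_mem_aIdeal (f g : PoissonR K d) : ⁅f, g⁆ ∈ aIdeal K d := by
  revert g
  refine PresentedPoisson.induction (p := fun f => ∀ g, ⁅f, g⁆ ∈ aIdeal K d) ?_ ?_ ?_ ?_ ?_ f
  · rintro (i | i) g
    · exact aIdeal_lie_mem (aGen_mem i) g
    · refine PresentedPoisson.induction
        (p := fun g => ⁅yGen K i, g⁆ ∈ aIdeal K d) ?_ ?_ ?_ ?_ ?_ g
      · rintro (j | j)
        · rw [← lie_skew]; exact neg_mem (aIdeal_lie_mem (aGen_mem j) _)
        · change ⁅yGen K i, yGen K j⁆ ∈ _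
          rw [yGen_lie_yGen]; exact zero_mem _
      · intro c
        rw [PresentedPoisson.lie_algebraMap]; exact zero_mem _
      · intro f g hf hg
        rw [lie_add]; exact add_mem hf hg
      · intro f g hf hg
        rw [PresentedPoisson.lie_mul]
        exact add_mem (Ideal.mul_mem_right _ _ hf) (Ideal.mul_mem_left _ _ hg)
      · intro f g hf hg
        rw [leibniz_lie, ← lie_skew f]
        exact add_mem (aIdeal_lie_mem hf _) (neg_mem (aIdeal_lie_mem hg _))
  · intro c g
    rw [← lie_skew, PresentedPoisson.lie_algebraMap, neg_zero]; exact zero_mem _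
  · intro f g hf hg h
    rw [add_lie]; exact add_mem (hf h) (hg h)
  · intro f g hf hg h
    rw [PresentedPoisson.mul_lie]
    exact add_mem (Ideal.mul_mem_right _ _ (hf h)) (Ideal.mul_mem_left _ _ (hg h))
  · intro f g hf _ h
    exact aIdeal_lie_mem (hf g) h

theorem aIdeal_mul_eq_zero {x y : PoissonR K d} (hx : x ∈ aIdeal K d) (hy : y ∈ aIdeal K d) :
    x * y = 0 := by
  have h : x * y ∈ aIdeal K d * aIdeal K d := Ideal.mul_mem_mul hx hy
  rw [aIdeal, Ideal.span_mul_span', Ideal.span_eq_bot.mpr ?_] at h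
  · simpa using h
  · rintro _ ⟨_, ⟨i, rfl⟩, _, ⟨j, rfl⟩, rfl⟩
    exact aGen_mul_aGen K i j

theorem aIdeal_lie_eq_zero {x y : PoissonR K d} (hx : x ∈ aIdeal K d) (hy : y ∈ aIdeal K d) :
    ⁅x, y⁆ = 0 := by
  have key : ∀ (i : Fin d), ⁅aGen K i, y⁆ = 0 := by
    intro i
    refine Submodule.span_induction ?_ ?_ ?_ ?_ hy
    · rintro _ ⟨j, rfl⟩
      exact aGen_lie_aGen K i j
    · exact lie_zero _
    · intro u v _ _ hu hv
      rw [lie_add, hu, hv, add_zero]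
    · intro c u hu' hu
      rw [smul_eq_mul, PresentedPoisson.lie_mul, hu, mul_zero, add_zero]
      exact aIdeal_mul_eq_zero (aIdeal_lie_mem (aGen_mem i) c) hu'
  refine Submodule.span_induction ?_ ?_ ?_ ?_ hx
  · rintro _ ⟨i, rfl⟩
    exact key i
  · exact zero_lie _
  · intro u v _ _ hu hv
    rw [add_lie, hu, hv, add_zero]
  · intro c u hu' hu
    rw [smul_eq_mul, PresentedPoisson.mul_lie, hu, mul_zero, add_zero]
    rw [← lie_skew]
    have := aIdeal_mul_eq_zero (aIdeal_lie_mem hy c) hu'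
    rw [neg_mul, this, neg_zero]

end PoissonR

/-! ## The free metabelian Lie algebra `F_d` -/

section FreeMetabelian

/-- The free metabelian Lie algebra `F_d = L_d / L_d''`, where `L_d` is the free Lie algebra on
`x_1, …, x_d` and `L_d'' = [[L_d, L_d], [L_d, L_d]]`. -/
abbrev FreeMetabelian (K : Type*) [CommRing K] (d : ℕ) : Type _ :=
  FreeLieAlgebra K (Fin d) ⧸ LieAlgebra.derivedSeries K (FreeLieAlgebra K (Fin d)) 2

variable (K : Type*) [CommRing K] {d : ℕ}

/-- The free generator `x_i` of `F_d`. -/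
noncomputable def xGen (i : Fin d) : FreeMetabelian K d :=
  LieSubmodule.Quotient.mk (FreeLieAlgebra.of K i)

variable {K} {L : Type*} [LieRing L] [LieAlgebra K L]

/-- A Lie algebra homomorphism from the free Lie algebra to a metabelian one kills `L_d''`. -/
theorem map_derivedSeries_two
    (hL : ∀ u v w z : L, ⁅⁅u, v⁆, ⁅w, z⁆⁆ = 0) (φ : FreeLieAlgebra K (Fin d) →ₗ⁅K⁆ L)
    {w : FreeLieAlgebra K (Fin d)}
    (hw : w ∈ LieAlgebra.derivedSeries K (FreeLieAlgebra K (Fin d)) 2) : φ w = 0 := by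
  have h2 : LieAlgebra.derivedSeries K L 2 = ⊥ := by
    rw [LieAlgebra.derivedSeries_def, LieAlgebra.derivedSeriesOfIdeal_succ,
      LieSubmodule.lie_eq_bot_iff]
    have h1 : ∀ x ∈ LieAlgebra.derivedSeriesOfIdeal K L 1 ⊤,
        x ∈ Submodule.span K {m : L | ∃ u v : L, ⁅u, v⁆ = m} := by
      intro x hx
      rw [LieAlgebra.derivedSeriesOfIdeal_succ, LieAlgebra.derivedSeriesOfIdeal_zero,
        ← LieSubmodule.mem_toSubmodule, LieSubmodule.lieIdeal_oper_eq_linear_span'] at hx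
      refine Submodule.span_mono ?_ hx
      rintro _ ⟨u, _, v, _, rfl⟩
      exact ⟨u, v, rfl⟩
    intro x hx y hy
    refine Submodule.span_induction ?_ (zero_lie _) ?_ ?_ (h1 x hx)
    · rintro _ ⟨u, v, rfl⟩
      refine Submodule.span_induction ?_ (lie_zero _) ?_ ?_ (h1 y hy)
      · rintro _ ⟨w, z, rfl⟩
        exact hL u v w z
      · intro a b _ _ ha hb
        rw [lie_add, ha, hb, add_zero]
      · intro c a _ ha
        rw [lie_smul, ha, smul_zero]
    · intro a b _ _ ha hb
      rw [add_lie, ha, hb, add_zero]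
    · intro c a _ ha
      rw [smul_lie, ha, smul_zero]
  have h := LieIdeal.derivedSeries_map_le (R := K) (f := φ) 2 (LieIdeal.mem_map hw)
  rw [h2] at h
  simpa using h

/-- The universal property of `F_d`: a map from the generators to a metabelian Lie algebra extends
to a homomorphism of Lie algebras. -/
noncomputable def FreeMetabelian.lift (hL : ∀ u v w z : L, ⁅⁅u, v⁆, ⁅w, z⁆⁆ = 0) (f : Fin d → L) :
    FreeMetabelian K d →ₗ⁅K⁆ L :=
  { Submodule.liftQ
      (LieAlgebra.derivedSeries K (FreeLieAlgebra K (Fin d)) 2).toSubmodule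
      (FreeLieAlgebra.lift K f : FreeLieAlgebra K (Fin d) →ₗ[K] L)
      (fun _ hw => map_derivedSeries_two hL (FreeLieAlgebra.lift K f) hw) with
    map_lie' := by
      rintro ⟨u⟩ ⟨v⟩
      exact LieHom.map_lie (FreeLieAlgebra.lift K f) u v }

theorem FreeMetabelian.lift_xGen (hL : ∀ u v w z : L, ⁅⁅u, v⁆, ⁅w, z⁆⁆ = 0) (f : Fin d → L)
    (i : Fin d) : FreeMetabelian.lift hL f (xGen K i) = f i :=
  FreeLieAlgebra.lift_of_apply f i

theorem FreeMetabelian.metabelian (u v w z : FreeMetabelian K d) : ⁅⁅u, v⁆, ⁅w, z⁆⁆ = 0 := by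
  rcases u with ⟨u⟩; rcases v with ⟨v⟩; rcases w with ⟨w⟩; rcases z with ⟨z⟩
  change (LieSubmodule.Quotient.mk ⁅⁅u, v⁆, ⁅w, z⁆⁆ : FreeMetabelian K d) = 0
  rw [← LieSubmodule.Quotient.mk'_apply, LieSubmodule.Quotient.mk_eq_zero]
  rw [LieAlgebra.derivedSeries_def, LieAlgebra.derivedSeriesOfIdeal_succ,
    LieAlgebra.derivedSeriesOfIdeal_succ, LieAlgebra.derivedSeriesOfIdeal_zero]
  exact LieSubmodule.lie_mem_lie (LieSubmodule.lie_mem_lie trivial trivial)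
    (LieSubmodule.lie_mem_lie trivial trivial)

variable (K d) in
/-- The embedding of `F_d` into `R_d` with `x_j = a_j + y_j`. -/
noncomputable def toPoissonR : FreeMetabelian K d →ₗ⁅K⁆ PoissonR K d :=
  FreeMetabelian.lift
    (fun u v w z => aIdeal_lie_eq_zero (lie_mem_aIdeal u v) (lie_mem_aIdeal w z))
    (fun j => aGen K j + yGen K j)

variable (K) in
/-- The inclusion `F_n → F_{n+1}`, `x_j ↦ x_j` for `1 ≤ j ≤ n`. -/
noncomputable def inclF (n : ℕ) : FreeMetabelian K n →ₗ⁅K⁆ FreeMetabelian K (n + 1) :=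
  FreeMetabelian.lift FreeMetabelian.metabelian (fun j => xGen K j.castSucc)

/-- The right multiplication `ad z : u ↦ [u, z]` (commutators being left normed,
`[u, z, z] = u ad² z`, and so on). -/
noncomputable def rightAd (z : FreeMetabelian K d) : Module.End K (FreeMetabelian K d) where
  toFun u := ⁅u, z⁆
  map_add' u v := add_lie u v z
  map_smul' c u := smul_lie c u z

/-- The operator `f(ad x_1, …, ad x_d)`. It is used on the commutator ideal `F_d'` only, where the
operators `ad x_i` commute, so that the order of the factors is irrelevant. -/
noncomputable def polyAd (f : MvPolynomial (Fin d) K) : Module.End K (FreeMetabelian K d) :=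
  ∑ m ∈ f.support,
    f.coeff m • ((List.finRange d).map fun i => rightAd (xGen K i) ^ m i).prod

/-- `u` is a (nonassociative) Lie monomial of degree `m` in the generators of `F_d`. -/
inductive IsLieMonomial : ℕ → FreeMetabelian K d → Prop
  | gen (i : Fin d) : IsLieMonomial 1 (xGen K i)
  | lie {p q : ℕ} {u v : FreeMetabelian K d} :
      IsLieMonomial p u → IsLieMonomial q v → IsLieMonomial (p + q) ⁅u, v⁆

variable (K d) in
/-- The homogeneous component `(F_d)_m` of degree `m` of `F_d`. -/
noncomputable def homComponent (m : ℕ) : Submodule K (FreeMetabelian K d) :=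
  Submodule.span K {u | IsLieMonomial m u}

end FreeMetabelian

/-! ## Linear actions and invariants -/

section Invariants

variable {K : Type*} [CommRing K] {d : ℕ}

/-- The endomorphism `f(x_1, …, x_d) ↦ f(g x_1, …, g x_d)` of `K[X_d]` given by the matrix
`α = (α_ij)` with `g x_j = ∑ i, α_ij x_i`. -/
noncomputable def actPoly (α : Matrix (Fin d) (Fin d) K) :
    MvPolynomial (Fin d) K →ₐ[K] MvPolynomial (Fin d) K :=
  MvPolynomial.aeval fun j => ∑ i, α i j • MvPolynomial.X i

/-- The endomorphism `f(x_1, …, x_d) ↦ f(g x_1, …, g x_d)` of `F_d` given by the matrix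
`α = (α_ij)` with `g x_j = ∑ i, α_ij x_i`. -/
noncomputable def actF (α : Matrix (Fin d) (Fin d) K) :
    FreeMetabelian K d →ₗ⁅K⁆ FreeMetabelian K d :=
  FreeMetabelian.lift FreeMetabelian.metabelian fun j => ∑ i, α i j • xGen K i

/-- The invariants `(F_d')^G` in the commutator ideal `F_d' = [F_d, F_d]`, where `g ∈ G` acts on
`K X_d` by the matrix `α g`. -/
noncomputable def invCommutator {G : Type*} (α : G → Matrix (Fin d) (Fin d) K) :
    Submodule K (FreeMetabelian K d) :=
  (LieAlgebra.derivedSeries K (FreeMetabelian K d) 1).toSubmodule ⊓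
    ⨅ g, LinearMap.eqLocus (actF (α g) : FreeMetabelian K d →ₗ[K] FreeMetabelian K d) LinearMap.id

/-- The invariants `ω(K[X_d])^G` in the augmentation ideal (the polynomials without constant term),
where `g ∈ G` acts on `K X_d` by the matrix `α g`. -/
noncomputable def invAugmentation {G : Type*} (α : G → Matrix (Fin d) (Fin d) K) :
    Submodule K (MvPolynomial (Fin d) K) :=
  (RingHom.ker (MvPolynomial.constantCoeff (σ := Fin d) (R := K))).restrictScalars K ⊓
    ⨅ g, LinearMap.eqLocus (actPoly (α g)).toLinearMap LinearMap.id

/-- A representation of `SL_2(K)` is rational if the matrix entries of `ρ g` are polynomials in the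
entries of `g`. -/
def IsRationalRep (ρ : Matrix.SpecialLinearGroup (Fin 2) K →* GL (Fin d) K) : Prop :=
  ∃ P : Fin d → Fin d → MvPolynomial (Fin 2 × Fin 2) K,
    ∀ g i j, (ρ g : Matrix (Fin d) (Fin d) K) i j =
      MvPolynomial.eval (fun p => (g : Matrix (Fin 2) (Fin 2) K) p.1 p.2) (P i j)

/-- The block of the representing matrices that describes the action on
`K X_n = span {x_1, …, x_n} ⊆ K X_{n+1}`, when this subspace is stable. -/
def restrictAction {n : ℕ} {G : Type*} [Group G] (ρ : G →* GL (Fin (n + 1)) K) (g : G) :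
    Matrix (Fin n) (Fin n) K :=
  (ρ g : Matrix (Fin (n + 1)) (Fin (n + 1)) K).submatrix Fin.castSucc Fin.castSucc

end Invariants

end MetabelianInvariants

open MetabelianInvariants

/-!
The algebra `R_d` has a concrete model: as a commutative algebra it is `K[Y_d] ⊕ ⨁ a_i K[Y_d]` with
`a_i a_j = 0`, and its bracket is `[f + m, g + m'] = E(g) m - E(f) m'`, where `E = ∑ y_i ∂/∂y_i` is
Euler's derivation (`WreathModel`). The commutator ideal `F_d'` lands in the vectors
`m = ∑ a_i m_i`, where `ad x_i` is multiplication by `y_i`, and `[x_i, x_j]` becomes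
`a_i y_j - a_j y_i`. Reading `a_i` as `dy_i`, contraction with Euler's vector field,
`m ↦ ∑ y_i m_i`, is a Koszul differential, and `F_d'` is exactly its kernel. This
is proved with Euler's homotopy: the exterior derivative of `m`, divided by the degree, gives the
inverse map once `dy_j ∧ dy_i` is replaced by `[x_i, x_j]` (`curl_divDegree_koszulMap`,
`exists_koszulMap_eq`). Injectivity of `F_d → R_d` follows, and all maps are equivariant
(`koszulMap_actF`).

Now single out the last variable `y = y_{n+1}`. A Koszul cycle in `n + 1` variables is determined by
its first `n` entries (`eq_of_coeffVec_eq`), and the coefficients `s_N` of `y^N` in these entries are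
vectors over `K[Y_n]`, arbitrary for `N > 0`, and a cycle for `N = 0`. As `y` is fixed and the span of
the other variables is stable, the cycle is invariant exactly when every `s_N` is. An invariant
vector `s` is uniquely the sum of an invariant cycle, that is, an element of `(F_n')^G`, and of the
gradient of an invariant `u` without constant term: contraction gives `E u = ∑ y_i s_i`, which
determines `u` since `E` is invertible, in characteristic zero, on polynomials without constant term.
The cycle `s y^N` contributes `v ad^N x_{n+1}`, and the gradient of `u` in degree `N + 1` contributes
`-π(x_{n+1}, u) y^N`. Thus `(F_{n+1}')^G` is isomorphic to the sum of countably many copies of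
`(F_n')^G` and of `ω(K[X_n])^G` (`invariantEquiv`), and bases are transported along this isomorphism.
-/

namespace MetabelianInvariants

/-! ### Euler's derivation and the polynomial Koszul complex -/

section Polynomials

open MvPolynomial

variable {K : Type*} [CommRing K] {d : ℕ}

variable (K d) in
/-- Euler's derivation `E = ∑ y_i ∂/∂y_i` of the polynomial ring. -/
noncomputable def euler : Derivation K (MvPolynomial (Fin d) K) (MvPolynomial (Fin d) K) :=
  mkDerivation K X

theorem euler_X (i : Fin d) : euler K d (X i) = X i := mkDerivation_X K _ i

theorem euler_apply (f : MvPolynomial (Fin d) K) : euler K d f = ∑ i, X i * pderiv i f := by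
  have hsum : ∀ g : MvPolynomial (Fin d) K,
      (∑ i : Fin d, (X i : MvPolynomial (Fin d) K) • pderiv i) g =
      ∑ i, X i * pderiv i g := by
    intro g
    have := congrFun (map_sum (Derivation.coeFnAddMonoidHom (R := K)
      (A := MvPolynomial (Fin d) K) (M := MvPolynomial (Fin d) K))
      (fun i : Fin d => (X i : MvPolynomial (Fin d) K) • pderiv i) Finset.univ) g
    exact this.trans (by simp only [Finset.sum_apply]; rfl)
  have h : euler K d = ∑ i : Fin d, (X i : MvPolynomial (Fin d) K) • pderiv i := by
    refine derivation_ext fun j => ?_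
    rw [euler_X, hsum, Finset.sum_eq_single j]
    · simp
    · intro i _ hij
      simp [pderiv_X_of_ne hij.symm]
    · simp
  rw [h, hsum]

theorem euler_monomial (s : Fin d →₀ ℕ) (r : K) :
    euler K d (monomial s r) = monomial s ((s.degree : K) * r) := by
  have h := (isHomogeneous_monomial (R := K) r (rfl : s.degree = s.degree)).sum_X_mul_pderiv
  rw [euler_apply, h, ← Nat.cast_smul_eq_nsmul K, smul_monomial, smul_eq_mul]

variable (K d) in
/-- The Koszul differential `m ↦ ∑ y_i m_i`, the contraction of `∑ m_i dy_i` with Euler's vector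
field. -/
noncomputable def contract :
    (Fin d → MvPolynomial (Fin d) K) →ₗ[MvPolynomial (Fin d) K] MvPolynomial (Fin d) K :=
  ∑ i, (X i : MvPolynomial (Fin d) K) • LinearMap.proj i

theorem contract_apply (m : Fin d → MvPolynomial (Fin d) K) :
    contract K d m = ∑ i, X i * m i := by
  simp [contract]

variable (K d) in
/-- The gradient `f ↦ (∂f/∂y_1, …, ∂f/∂y_d)`. -/
noncomputable def grad : MvPolynomial (Fin d) K →ₗ[K] (Fin d → MvPolynomial (Fin d) K) :=
  LinearMap.pi fun i => (pderiv i).toLinearMap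

@[simp]
theorem grad_apply (f : MvPolynomial (Fin d) K) (i : Fin d) : grad K d f i = pderiv i f := rfl

theorem contract_grad (f : MvPolynomial (Fin d) K) : contract K d (grad K d f) = euler K d f := by
  rw [contract_apply, euler_apply]; rfl

theorem constantCoeff_contract (m : Fin d → MvPolynomial (Fin d) K) :
    constantCoeff (contract K d m) = 0 := by
  simp [contract_apply]

/-- The action on vectors `∑ m_i dy_i` of polynomials that is induced by `y_j ↦ ∑ α_ij y_i`. -/
noncomputable def actVec (α : Matrix (Fin d) (Fin d) K) :
    (Fin d → MvPolynomial (Fin d) K) →ₗ[K] (Fin d → MvPolynomial (Fin d) K) :=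
  LinearMap.pi fun i => ∑ j, α i j • ((actPoly α).toLinearMap ∘ₗ LinearMap.proj j)

theorem actVec_apply (α : Matrix (Fin d) (Fin d) K) (m : Fin d → MvPolynomial (Fin d) K)
    (i : Fin d) : actVec α m i = ∑ j, α i j • actPoly α (m j) := by
  simp [actVec]

theorem actPoly_X (α : Matrix (Fin d) (Fin d) K) (j : Fin d) :
    actPoly α (X j) = ∑ i, α i j • X i := by
  simp [actPoly]

theorem contract_actVec (α : Matrix (Fin d) (Fin d) K) (m : Fin d → MvPolynomial (Fin d) K) :
    contract K d (actVec α m) = actPoly α (contract K d m) := by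
  simp only [contract_apply, actVec_apply, map_sum, map_mul, actPoly_X, Finset.mul_sum,
    Finset.sum_mul]
  rw [Finset.sum_comm]
  simp

/-- The chain rule for a linear substitution. -/
theorem grad_actPoly (α : Matrix (Fin d) (Fin d) K) (f : MvPolynomial (Fin d) K) :
    grad K d (actPoly α f) = actVec α (grad K d f) := by
  ext1 i
  simp only [grad_apply, actVec_apply]
  induction f using MvPolynomial.induction_on with
  | C a => simp [actPoly, algHom_C, ← algebraMap_eq]
  | add p q hp hq => simp [hp, hq, Finset.sum_add_distrib]
  | mul_X p j hp =>
    have hj : pderiv i (actPoly α (X j)) = C (α i j) := by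
      rw [actPoly_X, map_sum, Finset.sum_eq_single i]
      · simp [smul_eq_C_mul]
      · intro b _ hb
        simp [pderiv_X_of_ne hb]
      · simp
    have hk : ∀ k, pderiv k (X j : MvPolynomial (Fin d) K) = if k = j then 1 else 0 := by
      intro k
      by_cases h : k = j
      · simp [h]
      · simp [h, pderiv_X_of_ne (Ne.symm h)]
    have hsum : ∑ x, α i x • (actPoly α p * actPoly α (if x = j then 1 else 0)) =
        actPoly α p * C (α i j) := by
      rw [Finset.sum_eq_single j]
      · simp [smul_eq_C_mul, mul_comm]
      · intro b _ hb
        simp [hb]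
      · simp
    simp only [map_mul, Derivation.leibniz, hp, hj, hk, smul_eq_mul, map_add, smul_add,
      Finset.sum_add_distrib, hsum, Finset.mul_sum, mul_smul_comm]

theorem euler_actPoly (α : Matrix (Fin d) (Fin d) K) (f : MvPolynomial (Fin d) K) :
    euler K d (actPoly α f) = actPoly α (euler K d f) := by
  rw [← contract_grad, grad_actPoly, contract_actVec, contract_grad]

theorem constantCoeff_actPoly (α : Matrix (Fin d) (Fin d) K) (f : MvPolynomial (Fin d) K) :
    constantCoeff (actPoly α f) = constantCoeff f := by
  induction f using MvPolynomial.induction_on with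
  | C a => simp [actPoly, ← algebraMap_eq]
  | add p q hp hq => simp [hp, hq]
  | mul_X p j hp => simp [actPoly_X]

end Polynomials

section DivDegree

open MvPolynomial

variable {K : Type*} [Field K] {d : ℕ}

variable (K d) in
/-- The linear operator dividing a form of degree `k` by `k + c`. For `c = 0` it annihilates the
constants, by the convention `0⁻¹ = 0`. -/
noncomputable def divDegree (c : ℕ) : MvPolynomial (Fin d) K →ₗ[K] MvPolynomial (Fin d) K :=
  (basisMonomials (Fin d) K).constr K fun s => monomial s ((s.degree + c : K)⁻¹)

theorem divDegree_monomial (c : ℕ) (s : Fin d →₀ ℕ) (r : K) :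
    divDegree K d c (monomial s r) = monomial s ((s.degree + c : K)⁻¹ * r) := by
  have h : (monomial s r : MvPolynomial (Fin d) K) = r • basisMonomials (Fin d) K s := by
    simp [smul_monomial]
  rw [h, map_smul, divDegree, Module.Basis.constr_basis, smul_monomial, smul_eq_mul, mul_comm]

theorem divDegree_X_mul (c : ℕ) (i : Fin d) (f : MvPolynomial (Fin d) K) :
    divDegree K d c (X i * f) = X i * divDegree K d (c + 1) f := by
  induction f using MvPolynomial.induction_on' with
  | monomial s r =>
    rw [X, monomial_mul, divDegree_monomial, divDegree_monomial, monomial_mul]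
    simp [add_assoc, add_comm]
  | add p q hp hq => simp only [mul_add, map_add, hp, hq]

theorem constantCoeff_divDegree_zero (f : MvPolynomial (Fin d) K) :
    constantCoeff (divDegree K d 0 f) = 0 := by
  induction f using MvPolynomial.induction_on' with
  | monomial s r =>
    rw [divDegree_monomial, constantCoeff_monomial]
    split_ifs with h
    · simp [h]
    · rfl
  | add p q hp hq => rw [map_add, map_add, hp, hq, add_zero]

theorem contract_divDegree_one (m : Fin d → MvPolynomial (Fin d) K) :
    contract K d (fun i => divDegree K d 1 (m i)) = divDegree K d 0 (contract K d m) := by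
  simp only [contract_apply, map_sum, divDegree_X_mul]

variable [CharZero K]

theorem euler_divDegree_zero (f : MvPolynomial (Fin d) K) :
    euler K d (divDegree K d 0 f) = f - C (constantCoeff f) := by
  induction f using MvPolynomial.induction_on' with
  | monomial s r =>
    rw [divDegree_monomial, euler_monomial, constantCoeff_monomial]
    split_ifs with h
    · subst h; simp
    · have : (s.degree : K) ≠ 0 := by
        rw [Nat.cast_ne_zero, Ne, Finsupp.degree_eq_zero_iff]; exact h
      simp [this]
  | add p q hp hq => simp only [map_add, hp, hq]; ring

theorem divDegree_zero_euler (f : MvPolynomial (Fin d) K) :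
    divDegree K d 0 (euler K d f) = f - C (constantCoeff f) := by
  induction f using MvPolynomial.induction_on' with
  | monomial s r =>
    rw [euler_monomial, divDegree_monomial, constantCoeff_monomial]
    split_ifs with h
    · subst h; simp
    · have : (s.degree : K) ≠ 0 := by
        rw [Nat.cast_ne_zero, Ne, Finsupp.degree_eq_zero_iff]; exact h
      simp [this]
  | add p q hp hq => simp only [map_add, hp, hq]; ring

theorem euler_divDegree_succ (c : ℕ) (f : MvPolynomial (Fin d) K) :
    euler K d (divDegree K d (c + 1) f) + (c + 1) • divDegree K d (c + 1) f = f := by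
  induction f using MvPolynomial.induction_on' with
  | monomial s r =>
    have : (s.degree : K) + (c + 1) ≠ 0 := by exact_mod_cast Nat.succ_ne_zero (s.degree + c)
    rw [divDegree_monomial, euler_monomial, ← Nat.cast_smul_eq_nsmul K, smul_monomial, ← map_add]
    congr 1
    push_cast
    rw [smul_eq_mul]
    field_simp
  | add p q hp hq =>
    simp only [map_add, smul_add]
    rw [add_add_add_comm, hp, hq]

theorem eq_zero_of_euler_eq_zero {f : MvPolynomial (Fin d) K} (hf : constantCoeff f = 0)
    (h : euler K d f = 0) : f = 0 := by
  have := divDegree_zero_euler f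
  rw [h, map_zero, hf, map_zero, sub_zero] at this
  exact this.symm

/-- Euler's homotopy is equivariant: in characteristic zero `divDegree 0` maps invariants without
constant term to invariants, as it inverts Euler's derivation. -/
theorem actPoly_divDegree_zero {α : Matrix (Fin d) (Fin d) K} {f : MvPolynomial (Fin d) K}
    (hf : constantCoeff f = 0) (h : actPoly α f = f) :
    actPoly α (divDegree K d 0 f) = divDegree K d 0 f := by
  rw [← sub_eq_zero]
  refine eq_zero_of_euler_eq_zero ?_ ?_
  · rw [map_sub, constantCoeff_actPoly, sub_self]
  · rw [map_sub, euler_actPoly, euler_divDegree_zero, hf, map_zero, sub_zero, h, sub_self]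

end DivDegree

/-! ### A concrete model of the Poisson algebra `R_d` -/

section Model

open MvPolynomial

variable (K : Type*) [CommRing K] (d : ℕ)

/-- The commutative algebra `K[Y_d] ⊕ ⨁ a_i K[Y_d]` with `a_i a_j = 0`, written as a trivial
square-zero extension; the second component `m` stands for `∑ a_i m_i`. Its Lie bracket is the Poisson bracket
determined by `[a_i, y_j] = a_i y_j`, and not the commutator. -/
def WreathModel : Type _ :=
  TrivSqZeroExt (MvPolynomial (Fin d) K) (Fin d → MvPolynomial (Fin d) K)

noncomputable instance : CommRing (WreathModel K d) :=
  inferInstanceAs (CommRing (TrivSqZeroExt _ _))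

noncomputable instance : Algebra K (WreathModel K d) :=
  inferInstanceAs (Algebra K (TrivSqZeroExt _ _))

namespace WreathModel

/-- The projection to `K[Y_d]`. -/
noncomputable def fst : WreathModel K d →ₗ[K] MvPolynomial (Fin d) K :=
  (TrivSqZeroExt.fstHom K (MvPolynomial (Fin d) K) (Fin d → MvPolynomial (Fin d) K)).toLinearMap

/-- The projection to the coefficients of the `a_i`. -/
noncomputable def snd : WreathModel K d →ₗ[K] (Fin d → MvPolynomial (Fin d) K) :=
  (TrivSqZeroExt.sndHom (MvPolynomial (Fin d) K) (Fin d → MvPolynomial (Fin d) K)).restrictScalars K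

variable {K d}

/-- The element `f + ∑ a_i m_i`. -/
noncomputable def mk (f : MvPolynomial (Fin d) K) (m : Fin d → MvPolynomial (Fin d) K) :
    WreathModel K d :=
  (f, m)

@[simp] theorem fst_mk (f m) : fst K d (mk f m) = f := rfl
@[simp] theorem snd_mk (f m) : snd K d (mk f m) = m := rfl

@[ext]
theorem ext {u v : WreathModel K d} (h1 : fst K d u = fst K d v) (h2 : snd K d u = snd K d v) :
    u = v :=
  TrivSqZeroExt.ext h1 h2

@[simp] theorem fst_mul (u v : WreathModel K d) : fst K d (u * v) = fst K d u * fst K d v := rfl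

@[simp] theorem snd_mul (u v : WreathModel K d) :
    snd K d (u * v) = fst K d u • snd K d v + fst K d v • snd K d u := by
  refine (TrivSqZeroExt.snd_mul _ _).trans ?_
  rw [op_smul_eq_smul]; rfl

@[simp] theorem fst_algebraMap (c : K) : fst K d (algebraMap K _ c) = C c := rfl
@[simp] theorem snd_algebraMap (c : K) : snd K d (algebraMap K _ c) = 0 := rfl

noncomputable instance : Bracket (WreathModel K d) (WreathModel K d) :=
  ⟨fun u v => mk 0 (euler K d (fst K d v) • snd K d u - euler K d (fst K d u) • snd K d v)⟩

@[simp] theorem fst_lie (u v : WreathModel K d) : fst K d ⁅u, v⁆ = 0 := rfl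

@[simp] theorem snd_lie (u v : WreathModel K d) :
    snd K d ⁅u, v⁆ = euler K d (fst K d v) • snd K d u - euler K d (fst K d u) • snd K d v := rfl

noncomputable instance : LieRing (WreathModel K d) where
  add_lie u v w := by ext1 <;> simp [add_smul]; abel
  lie_add u v w := by ext1 <;> simp [add_smul]; abel
  lie_self u := by ext1 <;> simp
  leibniz_lie u v w := by
    ext1
    · simp
    · simp only [snd_lie, fst_lie, map_zero, map_add, zero_smul]
      module

noncomputable instance : LieAlgebra K (WreathModel K d) where
  lie_smul c u v := by
    ext1 <;> simp [smul_sub]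
    rw [smul_comm]

theorem mul_lie (u v w : WreathModel K d) : ⁅u * v, w⁆ = ⁅u, w⁆ * v + u * ⁅v, w⁆ := by
  ext1
  · simp
  · simp only [snd_lie, fst_mul, snd_mul, fst_lie, map_add, Derivation.leibniz, smul_eq_mul]
    module

variable (K) in
/-- The images of the generators `a_i`, `y_i`. -/
noncomputable def generator : Fin d ⊕ Fin d → WreathModel K d :=
  Sum.elim (fun i => mk 0 (Pi.single i 1)) (fun i => mk (X i) 0)

/-- The value of a formal Poisson polynomial. -/
noncomputable def termValue : PoissonTerm K (Fin d ⊕ Fin d) → WreathModel K d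
  | .gen x => generator K x
  | .scalar c => algebraMap K _ c
  | .add f g => termValue f + termValue g
  | .mul f g => termValue f * termValue g
  | .brk f g => ⁅termValue f, termValue g⁆

theorem termValue_eq_of_wreathRel {f g : PoissonTerm K (Fin d ⊕ Fin d)} (h : WreathRel K d f g) :
    termValue f = termValue g := by
  cases h <;> ext1 <;> simp [termValue, generator, euler_X]

theorem termValue_eq_of_rel {f g : PoissonTerm K (Fin d ⊕ Fin d)}
    (h : PoissonRel (WreathRel K d) f g) : termValue f = termValue g := by
  induction h with
  | of_rel h => exact termValue_eq_of_wreathRel h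
  | add_scalar => exact map_add _ _ _
  | mul_scalar => exact map_mul _ _ _
  | add_assoc => exact _root_.add_assoc _ _ _
  | add_comm => exact _root_.add_comm _ _
  | zero_add => simp [termValue]
  | mul_assoc => exact _root_.mul_assoc _ _ _
  | mul_comm => exact _root_.mul_comm _ _
  | one_mul => simp [termValue]
  | zero_mul => simp [termValue]
  | mul_add => exact _root_.mul_add _ _ _
  | add_brk => exact add_lie _ _ _
  | brk_add => exact lie_add _ _ _
  | @brk_smul c f g =>
    simp only [termValue, ← Algebra.smul_def]
    exact lie_smul c (termValue f) (termValue g)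
  | brk_self => simp [termValue]
  | jacobi => exact leibniz_lie _ _ _
  | leibniz => exact mul_lie _ _ _
  | add_left _ h => simp only [termValue, h]
  | add_right _ h => simp only [termValue, h]
  | mul_left _ h => simp only [termValue, h]
  | mul_right _ h => simp only [termValue, h]
  | brk_left _ h => simp only [termValue, h]
  | brk_right _ h => simp only [termValue, h]

variable (K d) in
/-- The homomorphism of Lie algebras from `R_d` to its model. -/
noncomputable def ofPoissonR : PoissonR K d →ₗ⁅K⁆ WreathModel K d where
  toFun := Quot.lift termValue fun _ _ => termValue_eq_of_rel
  map_add' := by rintro ⟨f⟩ ⟨g⟩; rfl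
  map_smul' := by
    rintro c ⟨f⟩
    exact (Algebra.smul_def c (termValue f)).symm
  map_lie' := by rintro ⟨f⟩ ⟨g⟩; rfl

theorem ofPoissonR_gen (i : Fin d) :
    ofPoissonR K d (aGen K i + yGen K i) = mk (X i) (Pi.single i 1) := by
  rw [map_add]
  change generator K (.inl i) + generator K (.inr i) = _
  ext1 <;> simp [generator]

end WreathModel

end Model

/-! ### The commutator ideal as a module of polynomials -/

section CommutatorModule

open MvPolynomial

variable {K : Type*} [CommRing K] {d : ℕ}

/-- Homomorphisms from `F_d` are determined by their values on the generators. -/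
theorem FreeMetabelian.hom_ext {L : Type*} [LieRing L] [LieAlgebra K L]
    {φ ψ : FreeMetabelian K d →ₗ⁅K⁆ L} (h : ∀ i, φ (xGen K i) = ψ (xGen K i)) : φ = ψ := by
  let q : FreeLieAlgebra K (Fin d) →ₗ⁅K⁆ FreeMetabelian K d :=
    { (LieAlgebra.derivedSeries K (FreeLieAlgebra K (Fin d)) 2).toSubmodule.mkQ with
      map_lie' := rfl }
  have hq : φ.comp q = ψ.comp q := FreeLieAlgebra.hom_ext h
  ext ⟨u⟩
  exact LieHom.congr_fun hq u

variable (K d) in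
/-- The commutator ideal `F_d'`. -/
noncomputable abbrev commutatorIdeal : LieIdeal K (FreeMetabelian K d) :=
  LieAlgebra.derivedSeries K (FreeMetabelian K d) 1

theorem derivedSeries_one_eq_span (L : Type*) [LieRing L] [LieAlgebra K L] :
    (LieAlgebra.derivedSeries K L 1).toSubmodule =
      Submodule.span K {m | ∃ u v : L, ⁅u, v⁆ = m} := by
  rw [LieAlgebra.derivedSeries_def, LieAlgebra.derivedSeriesOfIdeal_succ,
    LieAlgebra.derivedSeriesOfIdeal_zero, LieSubmodule.lieIdeal_oper_eq_linear_span']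
  simp

theorem commutatorIdeal_eq_span :
    (commutatorIdeal K d).toSubmodule =
      Submodule.span K {m | ∃ u v : FreeMetabelian K d, ⁅u, v⁆ = m} :=
  derivedSeries_one_eq_span _

theorem lie_mem_commutatorIdeal (u v : FreeMetabelian K d) : ⁅u, v⁆ ∈ commutatorIdeal K d := by
  rw [← LieSubmodule.mem_toSubmodule, commutatorIdeal_eq_span]
  exact Submodule.subset_span ⟨u, v, rfl⟩

theorem lie_mem_of_mem_span {L : Type*} [LieRing L] [LieAlgebra K L] {s t : Set L}
    {S : Submodule K L} (h : ∀ a ∈ s, ∀ b ∈ t, ⁅a, b⁆ ∈ S) {a b : L}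
    (ha : a ∈ Submodule.span K s) (hb : b ∈ Submodule.span K t) : ⁅a, b⁆ ∈ S := by
  induction ha, hb using Submodule.span_induction₂ with
  | mem_mem x y hx hy => exact h x hx y hy
  | zero_left => rw [zero_lie]; exact zero_mem _
  | zero_right => rw [lie_zero]; exact zero_mem _
  | add_left x y z _ _ _ h1 h2 => rw [add_lie]; exact add_mem h1 h2
  | add_right x y z _ _ _ h1 h2 => rw [lie_add]; exact add_mem h1 h2
  | smul_left c x y _ _ h => rw [smul_lie]; exact S.smul_mem c h
  | smul_right c x y _ _ h => rw [lie_smul]; exact S.smul_mem c h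

theorem lie_eq_zero_of_mem_commutatorIdeal {u v : FreeMetabelian K d}
    (hu : u ∈ commutatorIdeal K d) (hv : v ∈ commutatorIdeal K d) : ⁅u, v⁆ = 0 := by
  rw [← LieSubmodule.mem_toSubmodule, commutatorIdeal_eq_span] at hu hv
  rw [← Submodule.mem_bot K]
  refine lie_mem_of_mem_span ?_ hu hv
  rintro _ ⟨u, v, rfl⟩ _ ⟨w, z, rfl⟩
  exact FreeMetabelian.metabelian u v w z

variable (K) in
/-- The operator `ad x_i` on `F_d'`. -/
noncomputable def adGen (i : Fin d) : Module.End K (commutatorIdeal K d) :=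
  (rightAd (xGen K i)).restrict (p := (commutatorIdeal K d).toSubmodule)
    (q := (commutatorIdeal K d).toSubmodule) fun u _ => lie_mem_commutatorIdeal u _

theorem coe_adGen (i : Fin d) (w : commutatorIdeal K d) :
    (adGen K i w : FreeMetabelian K d) = ⁅(w : FreeMetabelian K d), xGen K i⁆ := rfl

theorem adGen_comm (i j : Fin d) : adGen K i * adGen K j = adGen K j * adGen K i := by
  ext w
  have h := leibniz_lie (w : FreeMetabelian K d) (xGen K j) (xGen K i)
  rw [lie_eq_zero_of_mem_commutatorIdeal w.2 (lie_mem_commutatorIdeal _ _),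
    ← lie_skew (xGen K j) ⁅(w : FreeMetabelian K d), xGen K i⁆, eq_comm, add_neg_eq_zero] at h
  exact h

instance isMulCommutative_adjoin_adGen :
    IsMulCommutative (Algebra.adjoin K (Set.range (adGen K (d := d)))) :=
  Algebra.isMulCommutative_adjoin K (by rintro _ ⟨i, rfl⟩ _ ⟨j, rfl⟩; exact adGen_comm i j)

open scoped IsMulCommutative in
variable (K d) in
/-- The operators `f(ad x_1, …, ad x_d)` on `F_d'`, where the `ad x_i` commute. -/
noncomputable def polyOp : MvPolynomial (Fin d) K →ₐ[K] Module.End K (commutatorIdeal K d) :=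
  (Algebra.adjoin K (Set.range (adGen K (d := d)))).val.comp
    (aeval fun i => (⟨adGen K i, Algebra.subset_adjoin ⟨i, rfl⟩⟩ :
      Algebra.adjoin K (Set.range (adGen K (d := d)))))

theorem polyOp_X (i : Fin d) : polyOp K d (X i) = adGen K i := by
  simp [polyOp]

variable (K) in
/-- The commutator `[x_i, x_j]` as an element of `F_d'`. -/
noncomputable def lieGen (i j : Fin d) : commutatorIdeal K d :=
  ⟨⁅xGen K i, xGen K j⁆, lie_mem_commutatorIdeal _ _⟩

theorem lieGen_skew (i j : Fin d) : lieGen K j i = -lieGen K i j := by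
  ext
  simp [lieGen]

theorem adGen_lieGen (p q j : Fin d) :
    adGen K q (lieGen K p j) - adGen K p (lieGen K q j) = adGen K j (lieGen K p q) := by
  ext
  have h := leibniz_lie (xGen K p) (xGen K q) (xGen K j)
  simp only [LieSubmodule.coe_sub, coe_adGen, lieGen]
  rw [← lie_skew ⁅xGen K p, xGen K j⁆, ← lie_skew ⁅xGen K q, xGen K j⁆, h]
  abel

/-- `F_d'` is generated by the commutators `[x_i, x_j]` as a module over the polynomial ring, and
`F_d` is spanned modulo `F_d'` by the generators. -/
theorem span_polyOp_lieGen_and_generators :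
    (∀ w : commutatorIdeal K d, w ∈ Submodule.span K
      {w | ∃ (f : MvPolynomial (Fin d) K) (p q : Fin d), polyOp K d f (lieGen K p q) = w}) ∧
    ∀ u : FreeMetabelian K d, ∃ c : Fin d → K, u - ∑ i, c i • xGen K i ∈ commutatorIdeal K d := by
  set P : Submodule K (commutatorIdeal K d) := Submodule.span K
      {w | ∃ (f : MvPolynomial (Fin d) K) (p q : Fin d), polyOp K d f (lieGen K p q) = w} with hP
  set S : Submodule K (FreeMetabelian K d) :=
    P.map (commutatorIdeal K d).toSubmodule.subtype with hS
  have hSD : S ≤ (commutatorIdeal K d).toSubmodule := by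
    rintro _ ⟨w, _, rfl⟩
    exact w.2
  set V : Submodule K (FreeMetabelian K d) := Submodule.span K (Set.range (xGen K)) with hV
  have hVV : ∀ a ∈ V, ∀ b ∈ V, ⁅a, b⁆ ∈ S := by
    intro a ha b hb
    refine lie_mem_of_mem_span ?_ ha hb
    rintro _ ⟨i, rfl⟩ _ ⟨j, rfl⟩
    exact ⟨lieGen K i j, Submodule.subset_span ⟨1, i, j, by simp⟩, rfl⟩
  have hSV : ∀ s ∈ S, ∀ b ∈ V, ⁅s, b⁆ ∈ S := by
    rintro _ ⟨s, hs, rfl⟩ b hb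
    refine Submodule.span_induction ?_ ?_ ?_ ?_ hb
    · rintro _ ⟨j, rfl⟩
      refine ⟨adGen K j s, ?_, rfl⟩
      change s ∈ P.comap (adGen K j)
      refine Submodule.span_le.2 ?_ hs
      rintro _ ⟨f, p, q, rfl⟩
      exact Submodule.subset_span ⟨X j * f, p, q, by simp [polyOp_X]⟩
    · simp
    · intro x y _ _ h1 h2
      rw [lie_add]; exact add_mem h1 h2
    · intro c x _ h
      rw [lie_smul]; exact S.smul_mem c h
  have hlie : ∀ u ∈ V ⊔ S, ∀ v ∈ V ⊔ S, ⁅u, v⁆ ∈ S := by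
    intro u hu v hv
    obtain ⟨a, ha, s, hs, rfl⟩ := Submodule.mem_sup.1 hu
    obtain ⟨b, hb, t, ht, rfl⟩ := Submodule.mem_sup.1 hv
    rw [add_lie, lie_add, lie_add, ← lie_skew a t,
      lie_eq_zero_of_mem_commutatorIdeal (hSD hs) (hSD ht), add_zero]
    exact add_mem (add_mem (hVV a ha b hb) (neg_mem (hSV t ht a ha))) (hSV s hs b hb)
  let H : LieSubalgebra K (FreeMetabelian K d) :=
    { V ⊔ S with lie_mem' := fun {u v} hu hv => Submodule.mem_sup_right (hlie u hu v hv) }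
  -- The identity of `F_d` factors through the subalgebra `H`, as it does so on the generators.
  have hH : ∀ u, u ∈ V ⊔ S := by
    intro u
    let φ : FreeMetabelian K d →ₗ⁅K⁆ H := FreeMetabelian.lift
      (fun u v w z => Subtype.ext (FreeMetabelian.metabelian (u : FreeMetabelian K d) v w z))
      (fun i => ⟨xGen K i, Submodule.mem_sup_left (Submodule.subset_span ⟨i, rfl⟩)⟩)
    have h : H.incl.comp φ = (LieHom.id : FreeMetabelian K d →ₗ⁅K⁆ FreeMetabelian K d) := by
      refine FreeMetabelian.hom_ext fun i => ?_
      rw [LieHom.comp_apply, FreeMetabelian.lift_xGen]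
      rfl
    have h2 := LieHom.congr_fun h u
    rw [LieHom.comp_apply, LieHom.id_apply] at h2
    rw [← h2]
    exact (φ u).2
  refine ⟨fun w => ?_, fun u => ?_⟩
  · have h : (commutatorIdeal K d).toSubmodule ≤ S := by
      rw [commutatorIdeal_eq_span, Submodule.span_le]
      rintro _ ⟨u, v, rfl⟩
      exact hlie u (hH u) v (hH v)
    obtain ⟨w', hw', h⟩ := h w.2
    rwa [← Subtype.ext h]
  · obtain ⟨a, ha, s, hs, rfl⟩ := Submodule.mem_sup.1 (hH u)
    obtain ⟨c, rfl⟩ := (Submodule.mem_span_range_iff_exists_fun K).1 ha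
    exact ⟨c, by rw [add_sub_cancel_left]; exact hSD hs⟩

end CommutatorModule

/-! ### The Koszul embedding of the commutator ideal -/

section KoszulMap

open MvPolynomial

variable {K : Type*} [CommRing K] {d : ℕ}

variable (K d) in
/-- The homomorphism from `F_d` to the model of `R_d`. -/
noncomputable def toModel : FreeMetabelian K d →ₗ⁅K⁆ WreathModel K d :=
  (WreathModel.ofPoissonR K d).comp (toPoissonR K d)

theorem toModel_xGen (i : Fin d) :
    toModel K d (xGen K i) = WreathModel.mk (X i) (Pi.single i 1) := by
  rw [toModel, LieHom.comp_apply, toPoissonR, FreeMetabelian.lift_xGen,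
    WreathModel.ofPoissonR_gen]

theorem fst_toModel_of_mem {w : FreeMetabelian K d} (hw : w ∈ commutatorIdeal K d) :
    WreathModel.fst K d (toModel K d w) = 0 := by
  rw [← LieSubmodule.mem_toSubmodule, commutatorIdeal_eq_span] at hw
  change w ∈ LinearMap.ker (WreathModel.fst K d ∘ₗ (toModel K d : FreeMetabelian K d →ₗ[K] _))
  refine Submodule.span_le.2 ?_ hw
  rintro _ ⟨u, v, rfl⟩
  change WreathModel.fst K d (toModel K d ⁅u, v⁆) = 0
  rw [LieHom.map_lie, WreathModel.fst_lie]

variable (K d) in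
/-- The coefficients `m_i` of the element `∑ a_i m_i` of `R_d` that corresponds to an element
of `F_d'`. On all of `F_d` the summand in `K[Y_d]` is dropped. -/
noncomputable def koszulMap : FreeMetabelian K d →ₗ[K] (Fin d → MvPolynomial (Fin d) K) :=
  WreathModel.snd K d ∘ₗ (toModel K d : FreeMetabelian K d →ₗ[K] WreathModel K d)

theorem koszulMap_lie_xGen {w : FreeMetabelian K d} (hw : w ∈ commutatorIdeal K d) (i : Fin d) :
    koszulMap K d ⁅w, xGen K i⁆ = (X i : MvPolynomial (Fin d) K) • koszulMap K d w := by
  change WreathModel.snd K d (toModel K d ⁅w, xGen K i⁆) = _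
  rw [LieHom.map_lie, WreathModel.snd_lie, fst_toModel_of_mem hw, toModel_xGen]
  simp only [WreathModel.fst_mk, euler_X, map_zero, zero_smul, sub_zero]
  rfl

theorem koszulMap_lieGen (i j : Fin d) :
    koszulMap K d (lieGen K i j) = Pi.single i (X j) - Pi.single j (X i) := by
  change WreathModel.snd K d (toModel K d ⁅xGen K i, xGen K j⁆) = _
  rw [LieHom.map_lie, WreathModel.snd_lie, toModel_xGen, toModel_xGen]
  simp [euler_X, ← Pi.single_smul]

theorem koszulMap_polyOp (f : MvPolynomial (Fin d) K) (w : commutatorIdeal K d) :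
    koszulMap K d (polyOp K d f w) = f • koszulMap K d w := by
  induction f using MvPolynomial.induction_on generalizing w with
  | C a =>
    rw [← algebraMap_eq, AlgHom.commutes, Module.algebraMap_end_apply, algebraMap_smul]
    exact map_smul _ a _
  | add p q hp hq =>
    rw [map_add, LinearMap.add_apply, add_smul, ← hp, ← hq]
    exact map_add _ _ _
  | mul_X p i hp =>
    rw [map_mul, polyOp_X, Module.End.mul_apply, hp, coe_adGen, koszulMap_lie_xGen w.2, mul_smul]

theorem contract_koszulMap {w : FreeMetabelian K d} (hw : w ∈ commutatorIdeal K d) :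
    contract K d (koszulMap K d w) = 0 := by
  have h := span_polyOp_lieGen_and_generators.1 ⟨w, hw⟩
  change (⟨w, hw⟩ : commutatorIdeal K d) ∈ LinearMap.ker ((contract K d).restrictScalars K ∘ₗ
    koszulMap K d ∘ₗ (commutatorIdeal K d).toSubmodule.subtype)
  refine Submodule.span_le.2 ?_ h
  rintro _ ⟨f, p, q, rfl⟩
  change contract K d (koszulMap K d (polyOp K d f (lieGen K p q))) = 0
  rw [koszulMap_polyOp, map_smul, koszulMap_lieGen, map_sub, contract_apply, contract_apply]
  simp [Pi.single_apply, mul_comm]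

/-- The action on the model of `R_d` compatible with `actF`. -/
noncomputable def actModel (α : Matrix (Fin d) (Fin d) K) :
    WreathModel K d →ₗ⁅K⁆ WreathModel K d where
  toFun u := WreathModel.mk (actPoly α (WreathModel.fst K d u)) (actVec α (WreathModel.snd K d u))
  map_add' u v := by ext1 <;> simp
  map_smul' c u := by ext1 <;> simp
  map_lie' {u v} := by
    have h : ∀ (f : MvPolynomial (Fin d) K) (m : Fin d → MvPolynomial (Fin d) K),
        actVec α (f • m) = actPoly α f • actVec α m := by
      intro f m
      ext1 i
      simp [actVec_apply, Finset.mul_sum]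
    ext1 <;> simp [euler_actPoly, h]

theorem koszulMap_actF (α : Matrix (Fin d) (Fin d) K) (u : FreeMetabelian K d) :
    koszulMap K d (actF α u) = actVec α (koszulMap K d u) := by
  have h : (toModel K d).comp (actF α) = (actModel α).comp (toModel K d) := by
    refine FreeMetabelian.hom_ext fun j => ?_
    rw [LieHom.comp_apply, LieHom.comp_apply, actF, FreeMetabelian.lift_xGen, toModel_xGen,
      map_sum]
    simp only [map_smul, toModel_xGen]
    ext1
    · simp [actModel, actPoly_X]
    · ext1 i
      simp [actModel, actVec_apply, Finset.sum_apply, Pi.single_apply, apply_ite, smul_eq_C_mul]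
  exact congrArg (WreathModel.snd K d) (LieHom.congr_fun h u)

variable (K d) in
/-- The de Rham differential followed by `dy_j ∧ dy_i ↦ [x_i, x_j]`. -/
noncomputable def curl : (Fin d → MvPolynomial (Fin d) K) →ₗ[K] commutatorIdeal K d :=
  ∑ i, ∑ j, LinearMap.applyₗ (lieGen K i j) ∘ₗ (polyOp K d).toLinearMap ∘ₗ
    (pderiv j).toLinearMap ∘ₗ LinearMap.proj i

theorem curl_apply (m : Fin d → MvPolynomial (Fin d) K) :
    curl K d m = ∑ i, ∑ j, polyOp K d (pderiv j (m i)) (lieGen K i j) := by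
  simp [curl]

theorem curl_single (p : Fin d) (g : MvPolynomial (Fin d) K) :
    curl K d (Pi.single p g) = ∑ j, polyOp K d (pderiv j g) (lieGen K p j) := by
  rw [curl_apply, Finset.sum_eq_single p]
  · simp
  · intro i _ hi
    simp [Pi.single_eq_of_ne hi]
  · simp

theorem polyOp_pderiv_X_mul (p q : Fin d) (f : MvPolynomial (Fin d) K) :
    ∑ j, polyOp K d (pderiv j (X q * f)) (lieGen K p j) = polyOp K d f (lieGen K p q) +
      ∑ j, polyOp K d (pderiv j f) (adGen K q (lieGen K p j)) := by
  simp only [Derivation.leibniz, map_add, LinearMap.add_apply, Finset.sum_add_distrib, smul_eq_mul]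
  rw [add_comm]
  congr 1
  · rw [Finset.sum_eq_single q]
    · simp
    · intro j _ hj
      simp [pderiv_X_of_ne hj.symm]
    · simp
  · refine Finset.sum_congr rfl fun j _ => ?_
    rw [mul_comm, map_mul, polyOp_X, Module.End.mul_apply]

/-- Euler's homotopy formula in degree two of the Koszul complex, a form of the Jacobi identity. -/
theorem curl_koszulMap_lieGen (p q : Fin d) (f : MvPolynomial (Fin d) K) :
    curl K d (f • koszulMap K d (lieGen K p q)) =
      polyOp K d (euler K d f + 2 • f) (lieGen K p q) := by
  have h1 : f • koszulMap K d (lieGen K p q) =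
      Pi.single p (X q * f) - Pi.single q (X p * f) := by
    rw [koszulMap_lieGen, smul_sub, ← Pi.single_smul, ← Pi.single_smul, smul_eq_mul, smul_eq_mul,
      mul_comm f, mul_comm f]
  have h2 : polyOp K d (euler K d f) (lieGen K p q) =
      ∑ j, polyOp K d (pderiv j f) (adGen K q (lieGen K p j)) -
        ∑ j, polyOp K d (pderiv j f) (adGen K p (lieGen K q j)) := by
    rw [← Finset.sum_sub_distrib, euler_apply, map_sum, LinearMap.sum_apply]
    refine Finset.sum_congr rfl fun j _ => ?_
    rw [← map_sub, adGen_lieGen, mul_comm, map_mul, polyOp_X, Module.End.mul_apply]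
  rw [h1, map_sub, curl_single, curl_single, polyOp_pderiv_X_mul, polyOp_pderiv_X_mul, map_add,
    LinearMap.add_apply, h2, lieGen_skew p q, map_neg, two_smul, map_add, LinearMap.add_apply]
  abel

/-- Euler's homotopy formula in degree one of the Koszul complex. -/
theorem koszulMap_curl {m : Fin d → MvPolynomial (Fin d) K} (hm : contract K d m = 0) (i : Fin d) :
    koszulMap K d (curl K d m) i = euler K d (m i) + m i := by
  have h1 : koszulMap K d (curl K d m) = ∑ p, ∑ j, pderiv j (m p) •
      ((Pi.single p (X j) : Fin d → MvPolynomial (Fin d) K) - Pi.single j (X p)) := by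
    change (koszulMap K d ∘ₗ (commutatorIdeal K d).toSubmodule.subtype) (curl K d m) = _
    rw [curl_apply, map_sum]
    refine Finset.sum_congr rfl fun p _ => ?_
    rw [map_sum]
    refine Finset.sum_congr rfl fun j _ => ?_
    rw [← koszulMap_lieGen, ← koszulMap_polyOp]
    rfl
  have h2 : ∑ p, X p * pderiv i (m p) + m i = 0 := by
    have := congrArg (pderiv i) hm
    rw [contract_apply, map_sum, map_zero] at this
    simp only [Derivation.leibniz, smul_eq_mul, Finset.sum_add_distrib] at this
    rw [← this]
    congr 1
    rw [Finset.sum_eq_single i]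
    · simp
    · intro b _ hb
      simp [pderiv_X_of_ne hb]
    · simp
  have h3 : koszulMap K d (curl K d m) i =
      ∑ j, X j * pderiv j (m i) - ∑ p, X p * pderiv i (m p) := by
    rw [h1]
    simp [Finset.sum_apply, mul_sub, Pi.single_apply, Finset.sum_sub_distrib, mul_comm (X _)]
  rw [h3, euler_apply]
  linear_combination -h2

end KoszulMap

section KoszulExact

open MvPolynomial

variable {K : Type*} [Field K] [CharZero K] {d : ℕ}

theorem curl_divDegree_koszulMap (w : commutatorIdeal K d) :
    curl K d (fun i => divDegree K d 1 (koszulMap K d w i)) = w := by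
  let D : (Fin d → MvPolynomial (Fin d) K) →ₗ[K] (Fin d → MvPolynomial (Fin d) K) :=
    (divDegree K d 1).compLeft (Fin d)
  have h := span_polyOp_lieGen_and_generators.1 w
  change w ∈ LinearMap.eqLocus (curl K d ∘ₗ D ∘ₗ
    koszulMap K d ∘ₗ (commutatorIdeal K d).toSubmodule.subtype) LinearMap.id
  refine Submodule.span_le.2 ?_ h
  rintro _ ⟨f, p, q, rfl⟩
  change curl K d (D (koszulMap K d (polyOp K d f (lieGen K p q)))) = _
  -- The entries of the vector of `[x_p, x_q]` are linear forms, which raises the shift from 1 to 2.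
  have hD : D (f • koszulMap K d (lieGen K p q)) =
      divDegree K d 2 f • koszulMap K d (lieGen K p q) := by
    have hs : ∀ (i j : Fin d) (g : MvPolynomial (Fin d) K),
        D (Pi.single i (g * X j)) = Pi.single i (divDegree K d 2 g * X j) := by
      intro i j g
      ext1 k
      by_cases hk : k = i
      · subst hk
        simp [D, mul_comm _ (X j), divDegree_X_mul]
      · simp [D, Pi.single_eq_of_ne hk]
    rw [koszulMap_lieGen, smul_sub, smul_sub, ← Pi.single_smul, ← Pi.single_smul, ← Pi.single_smul,
      ← Pi.single_smul, map_sub]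
    simp only [smul_eq_mul, hs]
  rw [koszulMap_polyOp, hD, curl_koszulMap_lieGen, euler_divDegree_succ]
  rfl

/-- Exactness of the Koszul complex at `K[Y_d]^d`, with the kernel identified with `F_d'`. -/
theorem exists_koszulMap_eq {m : Fin d → MvPolynomial (Fin d) K} (hm : contract K d m = 0) :
    ∃ w ∈ commutatorIdeal K d, koszulMap K d w = m := by
  refine ⟨curl K d (fun i => divDegree K d 1 (m i)), SetLike.coe_mem _, ?_⟩
  ext1 i
  rw [koszulMap_curl]
  · simpa using euler_divDegree_succ 0 (m i)
  · rw [contract_divDegree_one, hm, map_zero]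

theorem koszulMap_injOn {w w' : FreeMetabelian K d} (hw : w ∈ commutatorIdeal K d)
    (hw' : w' ∈ commutatorIdeal K d) (h : koszulMap K d w = koszulMap K d w') : w = w' := by
  have h1 := curl_divDegree_koszulMap ⟨w, hw⟩
  have h2 := curl_divDegree_koszulMap ⟨w', hw'⟩
  rw [show koszulMap K d (⟨w, hw⟩ : commutatorIdeal K d) =
    koszulMap K d (⟨w', hw'⟩ : commutatorIdeal K d) from h, h2] at h1
  exact (congrArg Subtype.val h1).symm

variable (K d) in
theorem toPoissonR_injective : Function.Injective (toPoissonR K d) := by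
  -- An element of the kernel has zero linear part, so it lies in `F_d'`, where `koszulMap` decides.
  suffices h : Function.Injective (toModel K d) from
    Function.Injective.of_comp (f := WreathModel.ofPoissonR K d) h
  rw [injective_iff_map_eq_zero]
  intro u hu
  obtain ⟨c, hc⟩ := span_polyOp_lieGen_and_generators.2 u
  have h1 := fst_toModel_of_mem hc
  rw [map_sub, hu, zero_sub, map_neg, neg_eq_zero, map_sum, map_sum] at h1
  simp only [map_smul, toModel_xGen, WreathModel.fst_mk] at h1
  have h2 : c = 0 := by
    funext i
    exact Fintype.linearIndependent_iff.1 (linearIndependent_X (Fin d) K) c h1 i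
  subst h2
  simp only [Pi.zero_apply, zero_smul, Finset.sum_const_zero, sub_zero] at hc
  refine koszulMap_injOn hc (zero_mem _) ?_
  change WreathModel.snd K d (toModel K d u) = WreathModel.snd K d (toModel K d 0)
  rw [hu, map_zero, map_zero, map_zero]

end KoszulExact

/-! ### Polynomial operators on the commutator ideal and their images -/

section PolyAd

open MvPolynomial

variable {K : Type*} [CommRing K] {d : ℕ}

theorem rightAd_pow_mem {w : FreeMetabelian K d} (hw : w ∈ commutatorIdeal K d)
    (z : FreeMetabelian K d) (m : ℕ) : (rightAd z ^ m) w ∈ commutatorIdeal K d := by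
  induction m with
  | zero => exact hw
  | succ m _ => rw [pow_succ']; exact lie_mem_commutatorIdeal _ _

theorem list_prod_rightAd_mem (m : Fin d → ℕ) (l : List (Fin d)) {w : FreeMetabelian K d}
    (hw : w ∈ commutatorIdeal K d) :
    (l.map fun i => rightAd (xGen K i) ^ m i).prod w ∈ commutatorIdeal K d := by
  induction l with
  | nil => exact hw
  | cons i l ih => rw [List.map_cons, List.prod_cons]; exact rightAd_pow_mem ih _ _

theorem polyAd_apply (f : MvPolynomial (Fin d) K) (w : FreeMetabelian K d) :
    polyAd f w = ∑ m ∈ f.support,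
      f.coeff m • ((List.finRange d).map fun i => rightAd (xGen K i) ^ m i).prod w := by
  simp [polyAd, LinearMap.sum_apply]

theorem polyAd_mem (f : MvPolynomial (Fin d) K) {w : FreeMetabelian K d}
    (hw : w ∈ commutatorIdeal K d) : polyAd f w ∈ commutatorIdeal K d := by
  rw [polyAd_apply]
  exact sum_mem fun m _ => (commutatorIdeal K d).toSubmodule.smul_mem _
    (list_prod_rightAd_mem m _ hw)

section Transfer

variable {B N : Type*} [CommRing B] [AddCommGroup N] [Module K N] [Module B N]
  {φ : FreeMetabelian K d →ₗ[K] N}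

theorem map_rightAd_pow {i : Fin d} {b : B}
    (h : ∀ w ∈ commutatorIdeal K d, φ ⁅w, xGen K i⁆ = b • φ w)
    {w : FreeMetabelian K d} (hw : w ∈ commutatorIdeal K d) (m : ℕ) :
    φ ((rightAd (xGen K i) ^ m) w) = b ^ m • φ w := by
  induction m with
  | zero => simp
  | succ m ih =>
    rw [pow_succ', Module.End.mul_apply, pow_succ', mul_smul, ← ih]
    exact h _ (rightAd_pow_mem hw _ m)

/-- A linear map that turns each `ad x_i` on `F_d'` into multiplication by `t_i` turns
`f(ad x_1, …, ad x_d)` into multiplication by `f(t_1, …, t_d)`. -/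
theorem map_polyAd [Algebra K B] [IsScalarTower K B N] {t : Fin d → B}
    (h : ∀ i, ∀ w ∈ commutatorIdeal K d, φ ⁅w, xGen K i⁆ = t i • φ w)
    (f : MvPolynomial (Fin d) K) {w : FreeMetabelian K d} (hw : w ∈ commutatorIdeal K d) :
    φ (polyAd f w) = aeval t f • φ w := by
  have hlist : ∀ (m : Fin d → ℕ) (l : List (Fin d)),
      φ ((l.map fun i => rightAd (xGen K i) ^ m i).prod w) =
        (l.map fun i => t i ^ m i).prod • φ w := by
    intro m l
    induction l with
    | nil => simp
    | cons i l ih =>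
      rw [List.map_cons, List.prod_cons, List.map_cons, List.prod_cons, mul_smul, ← ih]
      exact map_rightAd_pow (h i) (list_prod_rightAd_mem m l hw) _
  rw [polyAd_apply, map_sum, aeval_def, eval₂_eq', Finset.sum_smul]
  refine Finset.sum_congr rfl fun m _ => ?_
  rw [map_smul, hlist, ← Algebra.smul_def, smul_assoc, ← List.ofFn_eq_map, List.prod_ofFn]

end Transfer

theorem koszulMap_polyAd (f : MvPolynomial (Fin d) K) {w : FreeMetabelian K d}
    (hw : w ∈ commutatorIdeal K d) : koszulMap K d (polyAd f w) = f • koszulMap K d w := by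
  rw [map_polyAd (t := X) (fun i w hw => koszulMap_lie_xGen hw i) f hw, aeval_X_left_apply]

theorem koszulMap_rightAd_pow {w : FreeMetabelian K d} (hw : w ∈ commutatorIdeal K d) (i : Fin d)
    (m : ℕ) : koszulMap K d ((rightAd (xGen K i) ^ m) w) =
      (X i ^ m : MvPolynomial (Fin d) K) • koszulMap K d w :=
  map_rightAd_pow (fun _ hw => koszulMap_lie_xGen hw i) hw m

theorem toPoissonR_xGen (i : Fin d) : toPoissonR K d (xGen K i) = aGen K i + yGen K i :=
  FreeMetabelian.lift_xGen _ _ i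

theorem toPoissonR_mem_aIdeal {w : FreeMetabelian K d} (hw : w ∈ commutatorIdeal K d) :
    toPoissonR K d w ∈ aIdeal K d := by
  rw [← LieSubmodule.mem_toSubmodule, commutatorIdeal_eq_span] at hw
  change w ∈ ((aIdeal K d).restrictScalars K).comap
    (toPoissonR K d : FreeMetabelian K d →ₗ[K] PoissonR K d)
  refine Submodule.span_le.2 ?_ hw
  rintro _ ⟨u, v, rfl⟩
  change toPoissonR K d ⁅u, v⁆ ∈ aIdeal K d
  rw [LieHom.map_lie]
  exact lie_mem_aIdeal _ _

theorem lie_yGen_of_mem_aIdeal {x : PoissonR K d} (hx : x ∈ aIdeal K d) (i : Fin d) :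
    ⁅x, yGen K i⁆ = yGen K i * x := by
  refine Submodule.span_induction ?_ ?_ ?_ ?_ hx
  · rintro _ ⟨j, rfl⟩
    rw [aGen_lie_yGen, mul_comm]
  · simp
  · intro x y _ _ hx hy
    rw [add_lie, hx, hy, mul_add]
  · intro c x hx' hx
    rw [smul_eq_mul, PresentedPoisson.mul_lie, hx,
      aIdeal_mul_eq_zero (lie_mem_aIdeal c _) hx', zero_add, mul_left_comm]

theorem toPoissonR_lie_xGen {w : FreeMetabelian K d} (hw : w ∈ commutatorIdeal K d) (i : Fin d) :
    toPoissonR K d ⁅w, xGen K i⁆ = yGen K i * toPoissonR K d w := by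
  have h := toPoissonR_mem_aIdeal hw
  rw [LieHom.map_lie, toPoissonR_xGen, lie_add, aIdeal_lie_eq_zero h (aGen_mem i), zero_add,
    lie_yGen_of_mem_aIdeal h]

theorem toPoissonR_rightAd_pow {w : FreeMetabelian K d} (hw : w ∈ commutatorIdeal K d) (i : Fin d)
    (m : ℕ) : toPoissonR K d ((rightAd (xGen K i) ^ m) w) = toPoissonR K d w * yGen K i ^ m := by
  rw [mul_comm]
  exact map_rightAd_pow (φ := (toPoissonR K d : FreeMetabelian K d →ₗ[K] PoissonR K d))
    (b := yGen K i) (fun _ hw => toPoissonR_lie_xGen hw i) hw m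

theorem toPoissonR_polyAd (f : MvPolynomial (Fin d) K) {w : FreeMetabelian K d}
    (hw : w ∈ commutatorIdeal K d) :
    toPoissonR K d (polyAd f w) =
      aeval (fun i => aGen K i + yGen K i) f * toPoissonR K d w := by
  refine map_polyAd (φ := (toPoissonR K d : FreeMetabelian K d →ₗ[K] PoissonR K d))
    (t := fun i => aGen K i + yGen K i) (fun i w hw => ?_) f hw
  refine (toPoissonR_lie_xGen hw i).trans ?_
  change _ = (aGen K i + yGen K i) * toPoissonR K d w
  rw [add_mul, aIdeal_mul_eq_zero (aGen_mem i) (toPoissonR_mem_aIdeal hw), zero_add]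

/-- The Leibniz rule for a polynomial in the second argument of the Poisson bracket. -/
theorem lie_aeval {σ Y : Type*} [Fintype σ] {r : PoissonTerm K Y → PoissonTerm K Y → Prop}
    (z : PresentedPoisson r) (t : σ → PresentedPoisson r) (f : MvPolynomial σ K) :
    ⁅z, aeval t f⁆ = ∑ k, aeval t (pderiv k f) * ⁅z, t k⁆ := by
  classical
  induction f using MvPolynomial.induction_on with
  | C a =>
    rw [aeval_C, PresentedPoisson.lie_algebraMap]
    simp
  | add p q hp hq => simp [lie_add, hp, hq, add_mul, Finset.sum_add_distrib]
  | mul_X p j hp =>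
    have hj : ∑ k, aeval t p * aeval t (pderiv k (X j : MvPolynomial σ K)) * ⁅z, t k⁆ =
        aeval t p * ⁅z, t j⁆ := by
      rw [Finset.sum_eq_single j]
      · simp
      · intro b _ hb
        simp [pderiv_X_of_ne hb.symm]
      · simp
    simp only [map_mul, aeval_X, PresentedPoisson.lie_mul, hp, Derivation.leibniz, smul_eq_mul,
      map_add, add_mul, Finset.sum_add_distrib, hj, Finset.sum_mul]
    rw [add_comm]
    congr 1
    exact Finset.sum_congr rfl fun k _ => by ring

end PolyAd

/-! ### Separating the last variable -/

section LastVariable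

open MvPolynomial

variable {K : Type*} [CommRing K] {n : ℕ}

variable (K n) in
/-- The isomorphism of `K[y_1, …, y_{n+1}]` with `K[y_1, …, y_n][y_{n+1}]`. -/
noncomputable def lastEquiv :
    MvPolynomial (Fin (n + 1)) K ≃ₐ[K] Polynomial (MvPolynomial (Fin n) K) :=
  (renameEquiv K finSuccEquivLast).trans (optionEquivLeft K (Fin n))

theorem lastEquiv_X_last : lastEquiv K n (X (Fin.last n)) = Polynomial.X := by
  simp [lastEquiv, optionEquivLeft_X_none]

theorem lastEquiv_X_castSucc (i : Fin n) :
    lastEquiv K n (X i.castSucc) = Polynomial.C (X i) := by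
  simp [lastEquiv, optionEquivLeft_X_some]

theorem lastEquiv_rename (f : MvPolynomial (Fin n) K) :
    lastEquiv K n (rename Fin.castSucc f) = Polynomial.C f := by
  induction f using MvPolynomial.induction_on with
  | C a =>
    rw [rename_C, ← algebraMap_eq, AlgEquiv.commutes]
    rfl
  | add p q hp hq => simp only [map_add, hp, hq]
  | mul_X p j hp => simp only [map_mul, hp, rename_X, lastEquiv_X_castSucc]

variable (K n) in
/-- The coefficient of `y_{n+1}^N`, a polynomial in the other variables. -/
noncomputable def lastCoeff (N : ℕ) : MvPolynomial (Fin (n + 1)) K →ₗ[K] MvPolynomial (Fin n) K :=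
  (Polynomial.lcoeff (MvPolynomial (Fin n) K) N).restrictScalars K ∘ₗ
    (lastEquiv K n).toLinearMap

theorem lastCoeff_apply (N : ℕ) (f : MvPolynomial (Fin (n + 1)) K) :
    lastCoeff K n N f = (lastEquiv K n f).coeff N := rfl

theorem eq_of_lastCoeff_eq {f g : MvPolynomial (Fin (n + 1)) K}
    (h : ∀ N, lastCoeff K n N f = lastCoeff K n N g) : f = g :=
  (lastEquiv K n).injective (Polynomial.ext h)

theorem lastCoeff_X_castSucc_mul (N : ℕ) (i : Fin n) (f : MvPolynomial (Fin (n + 1)) K) :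
    lastCoeff K n N (X i.castSucc * f) = X i * lastCoeff K n N f := by
  simp [lastCoeff_apply, lastEquiv_X_castSucc]

theorem lastCoeff_zero_X_last_mul (f : MvPolynomial (Fin (n + 1)) K) :
    lastCoeff K n 0 (X (Fin.last n) * f) = 0 := by
  simp [lastCoeff_apply, lastEquiv_X_last]

theorem lastCoeff_succ_X_last_mul (N : ℕ) (f : MvPolynomial (Fin (n + 1)) K) :
    lastCoeff K n (N + 1) (X (Fin.last n) * f) = lastCoeff K n N f := by
  simp [lastCoeff_apply, lastEquiv_X_last]

theorem lastCoeff_X_last_pow_mul_rename (N M : ℕ) (f : MvPolynomial (Fin n) K) :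
    lastCoeff K n N (X (Fin.last n) ^ M * rename Fin.castSucc f) = if N = M then f else 0 := by
  simp [lastCoeff_apply, lastEquiv_X_last, lastEquiv_rename, Polynomial.coeff_X_pow]

/-- A matrix that fixes the last basis vector and stabilizes the span of the others, that is, the
block sum of the matrix `α` and the identity of size one. -/
structure IsBlockExtension (β : Matrix (Fin (n + 1)) (Fin (n + 1)) K)
    (α : Matrix (Fin n) (Fin n) K) : Prop where
  castSucc_castSucc : ∀ i j : Fin n, β i.castSucc j.castSucc = α i j
  castSucc_last : ∀ i : Fin n, β i.castSucc (Fin.last n) = 0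
  last_castSucc : ∀ j : Fin n, β (Fin.last n) j.castSucc = 0
  last_last : β (Fin.last n) (Fin.last n) = 1

theorem lastEquiv_actPoly {β : Matrix (Fin (n + 1)) (Fin (n + 1)) K} {α : Matrix (Fin n) (Fin n) K}
    (h : IsBlockExtension β α) (f : MvPolynomial (Fin (n + 1)) K) :
    lastEquiv K n (actPoly β f) =
      (lastEquiv K n f).map (actPoly α : MvPolynomial (Fin n) K →+* MvPolynomial (Fin n) K) := by
  have hext : (lastEquiv K n : _ →ₐ[K] _).comp (actPoly β) =
      (Polynomial.mapAlgHom (actPoly α)).comp (lastEquiv K n : _ →ₐ[K] _) := by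
    refine algHom_ext fun j => ?_
    refine Fin.lastCases ?_ (fun j => ?_) j
    · simp [actPoly_X, Fin.sum_univ_castSucc, h.castSucc_last, h.last_last, lastEquiv_X_last]
    · simp [actPoly_X, Fin.sum_univ_castSucc, h.castSucc_castSucc, h.last_castSucc,
        lastEquiv_X_castSucc, Polynomial.smul_C]
  exact DFunLike.congr_fun hext f

theorem lastCoeff_actPoly {β : Matrix (Fin (n + 1)) (Fin (n + 1)) K} {α : Matrix (Fin n) (Fin n) K}
    (h : IsBlockExtension β α) (N : ℕ) (f : MvPolynomial (Fin (n + 1)) K) :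
    lastCoeff K n N (actPoly β f) = actPoly α (lastCoeff K n N f) := by
  simp [lastCoeff_apply, lastEquiv_actPoly h]

variable (K n) in
/-- The coefficient of `y_{n+1}^N` in the first `n` entries of a vector of polynomials. -/
noncomputable def coeffVec (N : ℕ) :
    (Fin (n + 1) → MvPolynomial (Fin (n + 1)) K) →ₗ[K] (Fin n → MvPolynomial (Fin n) K) :=
  LinearMap.pi fun i => lastCoeff K n N ∘ₗ LinearMap.proj i.castSucc

@[simp]
theorem coeffVec_apply (N : ℕ) (s : Fin (n + 1) → MvPolynomial (Fin (n + 1)) K) (i : Fin n) :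
    coeffVec K n N s i = lastCoeff K n N (s i.castSucc) := rfl

theorem coeffVec_actVec {β : Matrix (Fin (n + 1)) (Fin (n + 1)) K} {α : Matrix (Fin n) (Fin n) K}
    (h : IsBlockExtension β α) (N : ℕ) (s : Fin (n + 1) → MvPolynomial (Fin (n + 1)) K) :
    coeffVec K n N (actVec β s) = actVec α (coeffVec K n N s) := by
  ext1 i
  simp [actVec_apply, Fin.sum_univ_castSucc, h.castSucc_castSucc, h.castSucc_last,
    lastCoeff_actPoly h]

theorem exists_coeffVec_eq_zero (s : Fin (n + 1) → MvPolynomial (Fin (n + 1)) K) :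
    ∃ B, ∀ N, B ≤ N → coeffVec K n N s = 0 := by
  refine ⟨(Finset.univ.sup fun i : Fin n => (lastEquiv K n (s i.castSucc)).natDegree) + 1,
    fun N hN => ?_⟩
  ext1 i
  refine Polynomial.coeff_eq_zero_of_natDegree_lt (lt_of_lt_of_le (Nat.lt_succ_of_le ?_) hN)
  exact Finset.le_sup (f := fun i : Fin n => (lastEquiv K n (s i.castSucc)).natDegree)
    (Finset.mem_univ i)

theorem contract_coeffVec_zero {s : Fin (n + 1) → MvPolynomial (Fin (n + 1)) K}
    (hs : contract K (n + 1) s = 0) : contract K n (coeffVec K n 0 s) = 0 := by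
  have h := congrArg (lastCoeff K n 0) hs
  rw [contract_apply, Fin.sum_univ_castSucc, map_add, lastCoeff_zero_X_last_mul, map_sum] at h
  simpa [contract_apply, lastCoeff_X_castSucc_mul] using h

theorem contract_coeffVec_succ {s : Fin (n + 1) → MvPolynomial (Fin (n + 1)) K}
    (hs : contract K (n + 1) s = 0) (N : ℕ) :
    contract K n (coeffVec K n (N + 1) s) = -lastCoeff K n N (s (Fin.last n)) := by
  have h := congrArg (lastCoeff K n (N + 1)) hs
  rw [contract_apply, Fin.sum_univ_castSucc, map_add, lastCoeff_succ_X_last_mul, map_sum,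
    map_zero] at h
  rw [eq_neg_iff_add_eq_zero, ← h]
  simp [contract_apply, lastCoeff_X_castSucc_mul]

/-- A Koszul cycle is determined by its first `n` entries. -/
theorem eq_of_coeffVec_eq {s s' : Fin (n + 1) → MvPolynomial (Fin (n + 1)) K}
    (hs : contract K (n + 1) s = 0) (hs' : contract K (n + 1) s' = 0)
    (h : ∀ N, coeffVec K n N s = coeffVec K n N s') : s = s' := by
  ext1 j
  refine Fin.lastCases ?_ (fun j => ?_) j
  · refine eq_of_lastCoeff_eq fun N => ?_
    rw [← neg_inj, ← contract_coeffVec_succ hs, ← contract_coeffVec_succ hs', h]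
  · exact eq_of_lastCoeff_eq fun N => congrFun (h N) j

theorem euler_rename (f : MvPolynomial (Fin n) K) :
    euler K (n + 1) (rename Fin.castSucc f) = rename Fin.castSucc (euler K n f) := by
  induction f using MvPolynomial.induction_on with
  | C a => rw [rename_C, derivation_C, derivation_C, map_zero]
  | add p q hp hq => simp only [map_add, hp, hq]
  | mul_X p j hp =>
    simp only [map_mul, rename_X, Derivation.leibniz, euler_X, hp, smul_eq_mul, map_add]

variable (K n) in
/-- The homomorphism of models compatible with `inclF`. -/
noncomputable def inclModel : WreathModel K n →ₗ⁅K⁆ WreathModel K (n + 1) where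
  toFun u := WreathModel.mk (rename Fin.castSucc (WreathModel.fst K n u))
    (Fin.snoc (fun i => rename Fin.castSucc (WreathModel.snd K n u i)) 0)
  map_add' u v := by
    ext1
    · simp
    · ext1 j
      refine Fin.lastCases ?_ (fun j => ?_) j <;> simp
  map_smul' c u := by
    ext1
    · simp
    · ext1 j
      refine Fin.lastCases ?_ (fun j => ?_) j <;> simp
  map_lie' {u v} := by
    ext1
    · simp
    · ext1 j
      refine Fin.lastCases ?_ (fun j => ?_) j <;> simp [euler_rename]

theorem koszulMap_inclF (u : FreeMetabelian K n) :
    koszulMap K (n + 1) (inclF K n u) =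
      Fin.snoc (fun i => rename Fin.castSucc (koszulMap K n u i)) 0 := by
  have h : (toModel K (n + 1)).comp (inclF K n) = (inclModel K n).comp (toModel K n) := by
    refine FreeMetabelian.hom_ext fun j => ?_
    rw [LieHom.comp_apply, LieHom.comp_apply, inclF, FreeMetabelian.lift_xGen, toModel_xGen,
      toModel_xGen]
    ext1
    · simp [inclModel]
    · ext1 i
      refine Fin.lastCases ?_ (fun i => ?_) i
      · simp [inclModel, Fin.castSucc_ne_last]
      · by_cases hij : i = j <;> simp [inclModel, Pi.single_apply, hij]
  exact congrArg (WreathModel.snd K (n + 1)) (LieHom.congr_fun h u)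

theorem inclF_mem {w : FreeMetabelian K n} (hw : w ∈ commutatorIdeal K n) :
    inclF K n w ∈ commutatorIdeal K (n + 1) := by
  rw [← LieSubmodule.mem_toSubmodule, commutatorIdeal_eq_span] at hw
  change w ∈ (commutatorIdeal K (n + 1)).toSubmodule.comap
    (inclF K n : FreeMetabelian K n →ₗ[K] FreeMetabelian K (n + 1))
  refine Submodule.span_le.2 ?_ hw
  rintro _ ⟨u, v, rfl⟩
  change inclF K n ⁅u, v⁆ ∈ commutatorIdeal K (n + 1)
  rw [LieHom.map_lie]
  exact lie_mem_commutatorIdeal _ _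

variable (K n) in
/-- The element `∑ [x_{n+1}, x_k] (∂f/∂x_k)(ad X_n) ad^N x_{n+1}` of `F_{n+1}'`. -/
noncomputable def lieGrad (N : ℕ) : MvPolynomial (Fin n) K →ₗ[K] commutatorIdeal K (n + 1) :=
  (adGen K (Fin.last n) ^ N : Module.End K (commutatorIdeal K (n + 1))) ∘ₗ ∑ k : Fin n,
    LinearMap.applyₗ (lieGen K (Fin.last n) k.castSucc) ∘ₗ (polyOp K (n + 1)).toLinearMap ∘ₗ
      (rename Fin.castSucc).toLinearMap ∘ₗ (pderiv k).toLinearMap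

theorem koszulMap_lieGrad_eq_smul (N : ℕ) (f : MvPolynomial (Fin n) K) :
    koszulMap K (n + 1) (lieGrad K n N f) = (X (Fin.last n) ^ N : MvPolynomial (Fin (n + 1)) K) •
      ∑ k : Fin n, rename Fin.castSucc (pderiv k f) •
        koszulMap K (n + 1) (lieGen K (Fin.last n) k.castSucc) := by
  have hsum : lieGrad K n N f = polyOp K (n + 1) (X (Fin.last n) ^ N) (∑ k : Fin n,
      polyOp K (n + 1) (rename Fin.castSucc (pderiv k f))
        (lieGen K (Fin.last n) k.castSucc)) := by
    simp [lieGrad, polyOp_X]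
  rw [hsum, koszulMap_polyOp]
  congr 1
  change (koszulMap K (n + 1) ∘ₗ (commutatorIdeal K (n + 1)).toSubmodule.subtype) _ = _
  rw [map_sum]
  refine Finset.sum_congr rfl fun k _ => ?_
  rw [← koszulMap_polyOp]
  rfl

theorem koszulMap_lieGrad (N : ℕ) (f : MvPolynomial (Fin n) K) :
    koszulMap K (n + 1) (lieGrad K n N f) = Fin.snoc
      (fun i => -(X (Fin.last n) ^ (N + 1) * rename Fin.castSucc (pderiv i f)))
      (X (Fin.last n) ^ N * rename Fin.castSucc (euler K n f)) := by
  rw [koszulMap_lieGrad_eq_smul]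
  simp only [koszulMap_lieGen]
  ext1 j
  refine Fin.lastCases ?_ (fun j => ?_) j
  · simp [Finset.sum_apply, Fin.castSucc_ne_last, euler_apply, mul_comm]
  · simp [Finset.sum_apply, Pi.single_apply, Fin.castSucc_ne_last]
    ring

theorem coeffVec_koszulMap_lieGrad (N M : ℕ) (f : MvPolynomial (Fin n) K) :
    coeffVec K n M (koszulMap K (n + 1) (lieGrad K n N f)) =
      if M = N + 1 then -grad K n f else 0 := by
  ext1 i
  rw [koszulMap_lieGrad, coeffVec_apply, Fin.snoc_castSucc, map_neg,
    lastCoeff_X_last_pow_mul_rename]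
  split_ifs <;> simp

theorem lastCoeff_koszulMap_lieGrad (N M : ℕ) (f : MvPolynomial (Fin n) K) :
    lastCoeff K n M (koszulMap K (n + 1) (lieGrad K n N f) (Fin.last n)) =
      if M = N then euler K n f else 0 := by
  rw [koszulMap_lieGrad, Fin.snoc_last, lastCoeff_X_last_pow_mul_rename]

variable (K n) in
/-- The map `w ↦ w ad^N x_{n+1}` from `F_n` to `F_{n+1}`. -/
noncomputable def inclAd (N : ℕ) : FreeMetabelian K n →ₗ[K] FreeMetabelian K (n + 1) :=
  (rightAd (xGen K (Fin.last n)) ^ N : Module.End K (FreeMetabelian K (n + 1))) ∘ₗ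
    (inclF K n : FreeMetabelian K n →ₗ[K] FreeMetabelian K (n + 1))

theorem inclAd_mem (N : ℕ) {w : FreeMetabelian K n} (hw : w ∈ commutatorIdeal K n) :
    inclAd K n N w ∈ commutatorIdeal K (n + 1) :=
  rightAd_pow_mem (inclF_mem hw) _ N

theorem koszulMap_inclAd (N : ℕ) {w : FreeMetabelian K n} (hw : w ∈ commutatorIdeal K n) :
    koszulMap K (n + 1) (inclAd K n N w) = (X (Fin.last n) ^ N : MvPolynomial (Fin (n + 1)) K) •
      (Fin.snoc (fun i => rename Fin.castSucc (koszulMap K n w i)) 0 :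
        Fin (n + 1) → MvPolynomial (Fin (n + 1)) K) := by
  rw [← koszulMap_inclF]
  exact koszulMap_rightAd_pow (inclF_mem hw) _ N

theorem coeffVec_koszulMap_inclAd (N M : ℕ) {w : FreeMetabelian K n}
    (hw : w ∈ commutatorIdeal K n) :
    coeffVec K n M (koszulMap K (n + 1) (inclAd K n N w)) =
      if M = N then koszulMap K n w else 0 := by
  ext1 i
  rw [koszulMap_inclAd N hw, coeffVec_apply, Pi.smul_apply, Fin.snoc_castSucc, smul_eq_mul,
    lastCoeff_X_last_pow_mul_rename]
  split_ifs <;> rfl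

theorem koszulMap_inclAd_last (N : ℕ) {w : FreeMetabelian K n} (hw : w ∈ commutatorIdeal K n) :
    koszulMap K (n + 1) (inclAd K n N w) (Fin.last n) = 0 := by
  rw [koszulMap_inclAd N hw, Pi.smul_apply, Fin.snoc_last, smul_zero]

end LastVariable

/-! ### Decomposition of the invariants -/

section Decomposition

open MvPolynomial

variable {K : Type*} [Field K] {n d : ℕ} {G : Type*}

theorem mem_invCommutator {α : G → Matrix (Fin d) (Fin d) K} {w : FreeMetabelian K d} :
    w ∈ invCommutator α ↔ w ∈ commutatorIdeal K d ∧ ∀ g, actF (α g) w = w := by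
  simp [invCommutator]

theorem mem_invAugmentation {α : G → Matrix (Fin d) (Fin d) K} {f : MvPolynomial (Fin d) K} :
    f ∈ invAugmentation α ↔ constantCoeff f = 0 ∧ ∀ g, actPoly (α g) f = f := by
  simp [invAugmentation]

theorem actF_mem (α : Matrix (Fin d) (Fin d) K) {w : FreeMetabelian K d}
    (hw : w ∈ commutatorIdeal K d) : actF α w ∈ commutatorIdeal K d := by
  rw [← LieSubmodule.mem_toSubmodule, commutatorIdeal_eq_span] at hw
  change w ∈ (commutatorIdeal K d).toSubmodule.comap
    (actF α : FreeMetabelian K d →ₗ[K] FreeMetabelian K d)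
  refine Submodule.span_le.2 ?_ hw
  rintro _ ⟨u, v, rfl⟩
  change actF α ⁅u, v⁆ ∈ commutatorIdeal K d
  rw [LieHom.map_lie]
  exact lie_mem_commutatorIdeal _ _

theorem actVec_koszulMap {α : G → Matrix (Fin d) (Fin d) K} {w : FreeMetabelian K d}
    (hw : w ∈ invCommutator α) (g : G) :
    actVec (α g) (koszulMap K d w) = koszulMap K d w := by
  rw [← koszulMap_actF, (mem_invCommutator.1 hw).2]

theorem actVec_grad {α : G → Matrix (Fin d) (Fin d) K} {f : MvPolynomial (Fin d) K}
    (hf : f ∈ invAugmentation α) (g : G) : actVec (α g) (grad K d f) = grad K d f := by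
  rw [← grad_actPoly, (mem_invAugmentation.1 hf).2]

/-- The elements `∑ [x_{n+1}, x_k] (∂f/∂x_k)(ad X_n) ad^m x_{n+1}` of `F_{n+1}'` are Poisson
brackets in `R_{n+1}`. -/
theorem toPoissonR_sum_polyAd (m : ℕ) (f : MvPolynomial (Fin n) K) :
    toPoissonR K (n + 1) (∑ k : Fin n, (rightAd (xGen K (Fin.last n)) ^ m)
        (polyAd (rename Fin.castSucc (pderiv k f)) ⁅xGen K (Fin.last n), xGen K k.castSucc⁆)) =
      poissonPi K (X (Fin.last n)) (rename Fin.castSucc f) * yGen K (Fin.last n) ^ m := by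
  rw [poissonPi, aeval_X, aeval_rename, lie_aeval, Finset.sum_mul, map_sum]
  refine Finset.sum_congr rfl fun k _ => ?_
  rw [toPoissonR_rightAd_pow (polyAd_mem _ (lie_mem_commutatorIdeal _ _)),
    toPoissonR_polyAd _ (lie_mem_commutatorIdeal _ _), aeval_rename, LieHom.map_lie,
    toPoissonR_xGen, toPoissonR_xGen]
  rfl

theorem isBlockExtension_restrictAction {H : Type*} [Group H] (ρ : H →* GL (Fin (n + 1)) K) (g : H)
    (hinv : (ρ g : Matrix (Fin (n + 1)) (Fin (n + 1)) K).mulVec (Pi.single (Fin.last n) 1) =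
      Pi.single (Fin.last n) 1)
    (hsub : ∀ w : Fin (n + 1) → K, w (Fin.last n) = 0 →
      (ρ g : Matrix (Fin (n + 1)) (Fin (n + 1)) K).mulVec w (Fin.last n) = 0) :
    IsBlockExtension (ρ g : Matrix (Fin (n + 1)) (Fin (n + 1)) K) (restrictAction ρ g) where
  castSucc_castSucc _ _ := rfl
  castSucc_last i := by
    have h := congrFun hinv i.castSucc
    rwa [Matrix.mulVec_single_one, Pi.single_eq_of_ne (Fin.castSucc_ne_last i)] at h
  last_castSucc j := by
    have h := hsub (Pi.single j.castSucc 1)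
      (Pi.single_eq_of_ne (Fin.castSucc_ne_last j).symm _)
    rwa [Matrix.mulVec_single_one] at h
  last_last := by
    have h := congrFun hinv (Fin.last n)
    rwa [Matrix.mulVec_single_one, Pi.single_eq_same] at h

variable (α : G → Matrix (Fin n) (Fin n) K)

/-- The map `(p, q) ↦ ∑ p_N ad^N x_{n+1} + ∑ π(x_{n+1}, q_N) ad^N x_{n+1}` on finite sequences of
invariants. -/
noncomputable def invariantMap :
    (ℕ →₀ invCommutator α) × (ℕ →₀ invAugmentation α) →ₗ[K] FreeMetabelian K (n + 1) :=
  LinearMap.coprod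
    (Finsupp.lsum K fun N => inclAd K n N ∘ₗ (invCommutator α).subtype)
    (Finsupp.lsum K fun N => (commutatorIdeal K (n + 1)).toSubmodule.subtype ∘ₗ
      lieGrad K n N ∘ₗ (invAugmentation α).subtype)

theorem invariantMap_single_left (N : ℕ) (p : invCommutator α) :
    invariantMap α (Finsupp.single N p, 0) = inclAd K n N p := by
  simp [invariantMap]

theorem invariantMap_single_right (N : ℕ) (q : invAugmentation α) :
    invariantMap α (0, Finsupp.single N q) = lieGrad K n N (q : MvPolynomial (Fin n) K) := by
  simp [invariantMap]

/-- To prove a linear property of all values of `invariantMap`, one may check the generators. -/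
theorem invariantMap_mem {S : Submodule K (FreeMetabelian K (n + 1))}
    (h1 : ∀ N (p : invCommutator α), inclAd K n N (p : FreeMetabelian K n) ∈ S)
    (h2 : ∀ N (q : invAugmentation α),
      (lieGrad K n N (q : MvPolynomial (Fin n) K) : FreeMetabelian K (n + 1)) ∈ S)
    (x : (ℕ →₀ invCommutator α) × (ℕ →₀ invAugmentation α)) : invariantMap α x ∈ S := by
  simp only [invariantMap, LinearMap.coprod_apply, Finsupp.lsum_apply, Finsupp.sum]
  exact add_mem (sum_mem fun N _ => h1 N _) (sum_mem fun N _ => h2 N _)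

theorem lastCoeff_koszulMap_invariantMap (N : ℕ)
    (x : (ℕ →₀ invCommutator α) × (ℕ →₀ invAugmentation α)) :
    lastCoeff K n N (koszulMap K (n + 1) (invariantMap α x) (Fin.last n)) =
      euler K n (x.2 N) := by
  let L : FreeMetabelian K (n + 1) →ₗ[K] MvPolynomial (Fin n) K :=
    lastCoeff K n N ∘ₗ LinearMap.proj (Fin.last n) ∘ₗ koszulMap K (n + 1)
  let R : (ℕ →₀ invCommutator α) × (ℕ →₀ invAugmentation α) →ₗ[K] MvPolynomial (Fin n) K :=
    (euler K n).toLinearMap ∘ₗ (invAugmentation α).subtype ∘ₗ Finsupp.lapply N ∘ₗ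
      LinearMap.snd K _ _
  suffices h : L ∘ₗ invariantMap α = R from DFunLike.congr_fun h x
  refine LinearMap.prod_ext (Finsupp.lhom_ext fun M p => ?_) (Finsupp.lhom_ext fun M q => ?_)
  · change lastCoeff K n N (koszulMap K (n + 1) (invariantMap α (Finsupp.single M p, 0)) _) =
      euler K n (((0 : ℕ →₀ invAugmentation α) N : invAugmentation α) : MvPolynomial (Fin n) K)
    rw [invariantMap_single_left, koszulMap_inclAd_last M (mem_invCommutator.1 p.2).1]
    simp
  · change lastCoeff K n N (koszulMap K (n + 1) (invariantMap α (0, Finsupp.single M q)) _) =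
      euler K n ((Finsupp.single M q N : invAugmentation α) : MvPolynomial (Fin n) K)
    rw [invariantMap_single_right, lastCoeff_koszulMap_lieGrad, Finsupp.single_apply]
    by_cases h : N = M
    · simp [h]
    · simp [h, Ne.symm h]

theorem coeffVec_koszulMap_invariantMap_left (N : ℕ) (p : ℕ →₀ invCommutator α) :
    coeffVec K n N (koszulMap K (n + 1) (invariantMap α (p, 0))) =
      koszulMap K n (p N : FreeMetabelian K n) := by
  let L : (ℕ →₀ invCommutator α) →ₗ[K] (Fin n → MvPolynomial (Fin n) K) :=
    coeffVec K n N ∘ₗ koszulMap K (n + 1) ∘ₗ invariantMap α ∘ₗ LinearMap.inl K _ _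
  let R : (ℕ →₀ invCommutator α) →ₗ[K] (Fin n → MvPolynomial (Fin n) K) :=
    koszulMap K n ∘ₗ (invCommutator α).subtype ∘ₗ Finsupp.lapply N
  suffices h : L = R from DFunLike.congr_fun h p
  refine Finsupp.lhom_ext fun M p => ?_
  change coeffVec K n N (koszulMap K (n + 1) (invariantMap α (Finsupp.single M p, 0))) =
    koszulMap K n ((Finsupp.single M p N : invCommutator α) : FreeMetabelian K n)
  rw [invariantMap_single_left, coeffVec_koszulMap_inclAd _ _ (mem_invCommutator.1 p.2).1,
    Finsupp.single_apply]
  by_cases h : N = M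
  · simp [h]
  · simp [h, Ne.symm h]

variable [CharZero K]

theorem mem_invCommutator_of_koszulMap {α : G → Matrix (Fin d) (Fin d) K} {w : FreeMetabelian K d}
    (hw : w ∈ commutatorIdeal K d)
    (h : ∀ g, actVec (α g) (koszulMap K d w) = koszulMap K d w) : w ∈ invCommutator α :=
  mem_invCommutator.2 ⟨hw, fun g =>
    koszulMap_injOn (actF_mem _ hw) hw (by rw [koszulMap_actF, h])⟩

theorem invariantMap_injective : Function.Injective (invariantMap α) := by
  rw [injective_iff_map_eq_zero]
  rintro ⟨p, q⟩ h
  have hq : q = 0 := by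
    ext1 N
    have h1 := lastCoeff_koszulMap_invariantMap α N (p, q)
    rw [h, map_zero, Pi.zero_apply, map_zero] at h1
    exact Subtype.ext
      (eq_zero_of_euler_eq_zero (mem_invAugmentation.1 (q N).2).1 h1.symm)
  subst hq
  have hp : p = 0 := by
    ext1 N
    have h1 := coeffVec_koszulMap_invariantMap_left α N p
    rw [h, map_zero, map_zero] at h1
    refine Subtype.ext (koszulMap_injOn (mem_invCommutator.1 (p N).2).1 (zero_mem _) ?_)
    exact h1.symm.trans (map_zero _).symm
  rw [hp]
  rfl

variable {α}

theorem invariantMap_mem_invCommutator {β : G → Matrix (Fin (n + 1)) (Fin (n + 1)) K}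
    (hβ : ∀ g, IsBlockExtension (β g) (α g))
    (x : (ℕ →₀ invCommutator α) × (ℕ →₀ invAugmentation α)) :
    invariantMap α x ∈ invCommutator β := by
  have key : ∀ w ∈ commutatorIdeal K (n + 1),
      (∀ N g, actVec (α g) (coeffVec K n N (koszulMap K (n + 1) w)) =
        coeffVec K n N (koszulMap K (n + 1) w)) → w ∈ invCommutator β := by
    intro w hw h
    refine mem_invCommutator_of_koszulMap hw fun g => ?_
    refine eq_of_coeffVec_eq ?_ (contract_koszulMap hw) fun N => ?_
    · rw [contract_actVec, contract_koszulMap hw, map_zero]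
    · rw [coeffVec_actVec (hβ g), h]
  refine invariantMap_mem α (fun N p => ?_) (fun N q => ?_) x
  · have hp := (mem_invCommutator.1 p.2).1
    refine key _ (inclAd_mem N hp) fun M g => ?_
    rw [coeffVec_koszulMap_inclAd N M hp]
    split_ifs
    · exact actVec_koszulMap p.2 g
    · exact map_zero _
  · refine key _ (SetLike.coe_mem _) fun M g => ?_
    rw [coeffVec_koszulMap_lieGrad]
    split_ifs
    · rw [map_neg, actVec_grad q.2]
    · exact map_zero _

/-- The vectors `s y_{n+1}^N` with `s` an invariant vector, completed to Koszul cycles, are values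
of `invariantMap`: for `N > 0` the vector `s` is the sum of the gradient of an invariant, which
accounts for its contraction, and of an invariant cycle. -/
theorem exists_invariantMap_coeffVec_eq {s : Fin n → MvPolynomial (Fin n) K}
    (hs : ∀ g, actVec (α g) s = s) (N : ℕ) (hN : N = 0 → contract K n s = 0) :
    ∃ x, ∀ M, coeffVec K n M (koszulMap K (n + 1) (invariantMap α x)) =
      if M = N then s else 0 := by
  have cycle : ∀ z : Fin n → MvPolynomial (Fin n) K, contract K n z = 0 →
      (∀ g, actVec (α g) z = z) → ∀ N, ∃ x, ∀ M,
        coeffVec K n M (koszulMap K (n + 1) (invariantMap α x)) = if M = N then z else 0 := by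
    intro z hz hα N
    obtain ⟨w, hw, rfl⟩ := exists_koszulMap_eq hz
    refine ⟨(Finsupp.single N ⟨w, mem_invCommutator_of_koszulMap hw hα⟩, 0), fun M => ?_⟩
    rw [invariantMap_single_left, coeffVec_koszulMap_inclAd N M hw]
  cases N with
  | zero => exact cycle s (hN rfl) hs 0
  | succ N =>
    set q := divDegree K n 0 (contract K n s) with hq
    have hc := constantCoeff_contract s
    have hqU : q ∈ invAugmentation α := by
      refine mem_invAugmentation.2 ⟨constantCoeff_divDegree_zero _, fun g => ?_⟩
      exact actPoly_divDegree_zero hc (by rw [← contract_actVec, hs])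
    obtain ⟨x, hx⟩ := cycle (s - grad K n q)
      (by rw [map_sub, contract_grad, hq, euler_divDegree_zero, hc, map_zero, sub_zero, sub_self])
      (fun g => by rw [map_sub, hs, actVec_grad hqU]) (N + 1)
    refine ⟨x + (0, Finsupp.single N ⟨-q, neg_mem hqU⟩), fun M => ?_⟩
    rw [map_add, map_add, map_add, hx, invariantMap_single_right, coeffVec_koszulMap_lieGrad]
    split_ifs
    · rw [map_neg]
      abel
    · exact add_zero 0

theorem exists_invariantMap_eq {β : G → Matrix (Fin (n + 1)) (Fin (n + 1)) K}
    (hβ : ∀ g, IsBlockExtension (β g) (α g)) {w : FreeMetabelian K (n + 1)}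
    (hw : w ∈ invCommutator β) : ∃ x, invariantMap α x = w := by
  have hwD := (mem_invCommutator.1 hw).1
  have hs := contract_koszulMap hwD
  have hx : ∀ N, ∃ x, ∀ M, coeffVec K n M (koszulMap K (n + 1) (invariantMap α x)) =
      if M = N then coeffVec K n N (koszulMap K (n + 1) w) else 0 := by
    intro N
    refine exists_invariantMap_coeffVec_eq (fun g => ?_) N ?_
    · rw [← coeffVec_actVec (hβ g), actVec_koszulMap hw]
    · rintro rfl
      exact contract_coeffVec_zero hs
  choose x hx using hx
  obtain ⟨B, hB⟩ := exists_coeffVec_eq_zero (koszulMap K (n + 1) w)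
  have hD := (mem_invCommutator.1
    (invariantMap_mem_invCommutator hβ (∑ N ∈ Finset.range B, x N))).1
  refine ⟨∑ N ∈ Finset.range B, x N, koszulMap_injOn hD hwD ?_⟩
  refine eq_of_coeffVec_eq (contract_koszulMap hD) hs fun M => ?_
  rw [map_sum, map_sum, map_sum]
  simp only [hx]
  rw [Finset.sum_ite_eq]
  split_ifs with hM
  · rfl
  · rw [hB M (by simpa using hM)]

/-- The isomorphism given by `invariantMap`. -/
noncomputable def invariantEquiv {β : G → Matrix (Fin (n + 1)) (Fin (n + 1)) K}
    (hβ : ∀ g, IsBlockExtension (β g) (α g)) :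
    ((ℕ →₀ invCommutator α) × (ℕ →₀ invAugmentation α)) ≃ₗ[K] invCommutator β :=
  LinearEquiv.ofBijective
    ((invariantMap α).codRestrict (invCommutator β) (invariantMap_mem_invCommutator hβ))
    ⟨fun _ _ h => invariantMap_injective α (congrArg Subtype.val h), fun w => by
      obtain ⟨x, hx⟩ := exists_invariantMap_eq hβ w.2
      exact ⟨x, Subtype.ext hx⟩⟩

theorem coe_invariantEquiv {β : G → Matrix (Fin (n + 1)) (Fin (n + 1)) K}
    (hβ : ∀ g, IsBlockExtension (β g) (α g))
    (x : (ℕ →₀ invCommutator α) × (ℕ →₀ invAugmentation α)) :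
    (invariantEquiv hβ x : FreeMetabelian K (n + 1)) = invariantMap α x := rfl

theorem coe_lieGrad (m : ℕ) (f : MvPolynomial (Fin n) K) :
    (lieGrad K n m f : FreeMetabelian K (n + 1)) =
      ∑ k : Fin n, (rightAd (xGen K (Fin.last n)) ^ m)
        (polyAd (rename Fin.castSucc (pderiv k f)) ⁅xGen K (Fin.last n), xGen K k.castSucc⁆) := by
  have hmem : ∀ k : Fin n,
      polyAd (rename Fin.castSucc (pderiv k f)) ⁅xGen K (Fin.last n), xGen K k.castSucc⁆ ∈
        commutatorIdeal K (n + 1) := fun k => polyAd_mem _ (lie_mem_commutatorIdeal _ _)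
  refine koszulMap_injOn (SetLike.coe_mem _) (sum_mem fun k _ => rightAd_pow_mem (hmem k) _ m) ?_
  rw [map_sum]
  have hk : ∀ k : Fin n, koszulMap K (n + 1) ((rightAd (xGen K (Fin.last n)) ^ m)
      (polyAd (rename Fin.castSucc (pderiv k f)) ⁅xGen K (Fin.last n), xGen K k.castSucc⁆)) =
      (X (Fin.last n) ^ m : MvPolynomial (Fin (n + 1)) K) •
        rename Fin.castSucc (pderiv k f) •
          koszulMap K (n + 1) (lieGen K (Fin.last n) k.castSucc) := by
    intro k
    rw [koszulMap_rightAd_pow (hmem k), koszulMap_polyAd _ (lie_mem_commutatorIdeal _ _)]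
    rfl
  rw [Finset.sum_congr rfl fun k _ => hk k, ← Finset.smul_sum, koszulMap_lieGrad_eq_smul]

end Decomposition

end MetabelianInvariants

theorem proposition3p1 {K : Type*} [Field K] [CharZero K] (n : ℕ)
    (ρ : Matrix.SpecialLinearGroup (Fin 2) K →* GL (Fin (n + 1)) K)
    (hρ : IsRationalRep ρ)
    -- the last generator is invariant
    (hinv : ∀ g, (ρ g : Matrix (Fin (n + 1)) (Fin (n + 1)) K).mulVec (Pi.single (Fin.last n) 1) =
      Pi.single (Fin.last n) 1)
    -- the span of the other generators is a submodule
    (hsub : ∀ g (w : Fin (n + 1) → K), w (Fin.last n) = 0 →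
      (ρ g : Matrix (Fin (n + 1)) (Fin (n + 1)) K).mulVec w (Fin.last n) = 0)
    {I J : Type*}
    (v : Module.Basis I K (invCommutator (restrictAction ρ)))
    (hv : ∀ i, ∃ m, (v i : FreeMetabelian K n) ∈ homComponent K n m)
    (u : Module.Basis J K (invAugmentation (restrictAction ρ)))
    (hu : ∀ j, ∃ m, (u j : MvPolynomial (Fin n) K).IsHomogeneous m) :
    Function.Injective (toPoissonR K (n + 1)) ∧
    ∃ b : Module.Basis ((I × ℕ) ⊕ (J × ℕ)) K
        (invCommutator fun g => (ρ g : Matrix (Fin (n + 1)) (Fin (n + 1)) K)),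
      (∀ i m,
        (b (Sum.inl (i, m)) : FreeMetabelian K (n + 1)) =
            (rightAd (xGen K (Fin.last n)) ^ m) (inclF K n (v i)) ∧
        toPoissonR K (n + 1) (b (Sum.inl (i, m))) =
            toPoissonR K (n + 1) (inclF K n (v i)) * yGen K (Fin.last n) ^ m) ∧
      (∀ j m,
        (b (Sum.inr (j, m)) : FreeMetabelian K (n + 1)) =
            ∑ k : Fin n, (rightAd (xGen K (Fin.last n)) ^ m)
              (polyAd (MvPolynomial.rename Fin.castSucc
                  (MvPolynomial.pderiv k (u j : MvPolynomial (Fin n) K)))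
                ⁅xGen K (Fin.last n), xGen K k.castSucc⁆) ∧
        toPoissonR K (n + 1) (b (Sum.inr (j, m))) =
            poissonPi K (MvPolynomial.X (Fin.last n))
                (MvPolynomial.rename Fin.castSucc (u j : MvPolynomial (Fin n) K)) *
              yGen K (Fin.last n) ^ m) := by
  have hβ := fun g => isBlockExtension_restrictAction ρ g (hinv g) (hsub g)
  let b := (((Finsupp.basis fun _ : ℕ => v).prod (Finsupp.basis fun _ : ℕ => u)).reindex
    (Equiv.sumCongr ((Equiv.sigmaEquivProd ℕ I).trans (Equiv.prodComm ℕ I))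
      ((Equiv.sigmaEquivProd ℕ J).trans (Equiv.prodComm ℕ J)))).map (invariantEquiv hβ)
  have hl : ∀ i m, (b (Sum.inl (i, m)) : FreeMetabelian K (n + 1)) =
      (rightAd (xGen K (Fin.last n)) ^ m) (inclF K n (v i)) := by
    intro i m
    have h : b (Sum.inl (i, m)) = invariantEquiv hβ (Finsupp.single m (v i), 0) := by
      simp [b, Module.Basis.prod_apply, Finsupp.coe_basis]
    rw [h, coe_invariantEquiv, invariantMap_single_left]
    rfl
  have hr : ∀ j m, (b (Sum.inr (j, m)) : FreeMetabelian K (n + 1)) =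
      lieGrad K n m (u j : MvPolynomial (Fin n) K) := by
    intro j m
    have h : b (Sum.inr (j, m)) = invariantEquiv hβ (0, Finsupp.single m (u j)) := by
      simp [b, Module.Basis.prod_apply, Finsupp.coe_basis]
    rw [h, coe_invariantEquiv, invariantMap_single_right]
  refine ⟨toPoissonR_injective K (n + 1), b, fun i m => ⟨hl i m, ?_⟩, fun j m => ?_⟩
  · rw [hl, toPoissonR_rightAd_pow (inclF_mem (mem_invCommutator.1 (v i).2).1)]
  · rw [hr, coe_lieGrad]
    exact ⟨rfl, toPoissonR_sum_polyAd m _⟩
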